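/- Let $L>2\pi\sqrt{\frac{\sqrt5}{\sqrt5-1}}$ be fixed and put $c_L=\frac12\sqrt{5-\frac{L^4}{(L^2-4\pi^2)^2}}$ (so $c_L>0$). For $c\in[0,c_L)$ let $r=1-c^2$, $s=5-4c^2$ and $$J_c=\left(\frac{-1+\sqrt{1+4r}}{2},\ \frac{-3+\sqrt{9+48r}}{4}\right).$$ For $\alpha_4\in J_c$ put $\beta=-4\alpha_4^2-4\alpha_4+3+16r$, $\alpha_1=\frac{-2\alpha_4-3-\sqrt3\sqrt\beta}{4}$, $\alpha_3=\frac{-2\alpha_4-3+\sqrt3\sqrt\beta}{4}$, $g=\frac{2}{\sqrt{\alpha_4(\alpha_3-\alpha_1)}}$, $$k^2=\frac{6\alpha_4^2+9\alpha_4-12r+\alpha_4\sqrt3\sqrt\beta}{2\sqrt3\,\alpha_4\sqrt\beta},\qquad T(\alpha_4,c)=\frac{2\sqrt{2\sqrt3\,s}\,K(k)}{\sqrt{\alpha_4\sqrt\beta}},$$ where $K(k)=\int_0^1\frac{dt}{\sqrt{(1-k^2t^2)(1-t^2)}}$, and define, with the Jacobi elliptic functions $\mathrm{sn}$ and $\mathrm{dn}$,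 $$\phi(x;\alpha_4,c)=\frac{\sqrt{\alpha_4}\;\mathrm{dn}\!\left(\frac{2}{g\sqrt{3s}}x,k\right)}{\sqrt{1+\frac{\alpha_4}{-\alpha_1}k^2\,\mathrm{sn}^2\!\left(\frac{2}{g\sqrt{3s}}x,k\right)}}.$$ Then: 1. For every $c\in[0,c_L)$ there is a unique $\alpha_4\in J_c$ with $T(\alpha_4,c)=L$; denote it by $\Lambda(c)$. There is an open interval $I_2$ such that $\Lambda$ is a smooth ($C^\infty$) function from $[0,c_L)$ to $I_2$, $k^2(\Lambda(c),c)\in(0,1)$ for every $c\in[0,c_L)$, and $\Lambda(c)$ is the only $\alpha\in I_2$ with $k^2(\alpha,c)\in(0,1)$ and $T(\alpha,c)=L$. 2. For every $c\in[0,c_L)$ the function $\phi_c=\phi(\cdot\,;\Lambda(c),c)$ has fundamental period $L$ and solves $-\phi''+\frac rs\phi-\frac1s(\phi^3+\phi^5)=0$ on $\mathbb R$. Moreover, for every $n\in\mathbb N$ the map $c\in[0,c_L)\mapsto\phi_c\in H^n_{per}([0,L])$ is smooth, where $\|f\|_{H^n_{per}}^2=L\sum_{k\in\mathbb Z}(1+|k|^2)^n|\hat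 f(k)|^2$ and $\hat f(k)$ are the Fourier coefficients of the $L$-periodic function $f$. -/

import Mathlib

open Real Set MeasureTheory
open scoped ContDiff

noncomputable section

namespace CubicQuintic

/-! ### Elliptic integrals and Jacobi elliptic functions -/

/-- Complete elliptic integral of the first kind of modulus `k`. -/
def ellipticK (k : ℝ) : ℝ :=
  ∫ t in (0 : ℝ)..1, 1 / √((1 - k ^ 2 * t ^ 2) * (1 - t ^ 2))

/-- Incomplete elliptic integral of the first kind,
`F(θ, k) = ∫₀^θ dϑ / √(1 - k² sin² ϑ)`. -/
def ellipticF (k θ : ℝ) : ℝ :=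
  ∫ ϑ in (0 : ℝ)..θ, 1 / √(1 - k ^ 2 * Real.sin ϑ ^ 2)

/-- Jacobi amplitude: the inverse function of `θ ↦ F(θ, k)`
(a bijection of `ℝ` when `0 ≤ k < 1`). -/
def jacobiAm (u k : ℝ) : ℝ := Function.invFun (ellipticF k) u

/-- Jacobi elliptic function `sn(u, k)`. -/
def jacobiSn (u k : ℝ) : ℝ := Real.sin (jacobiAm u k)

/-- Jacobi elliptic function `dn(u, k)`. -/
def jacobiDn (u k : ℝ) : ℝ := √(1 - k ^ 2 * jacobiSn u k ^ 2)

/-! ### The parameters and the dnoidal profile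

`c` is the wave speed and `α` stands for the largest root `α₄`. -/

/-- `r = 1 - c²`. -/
def rOf (c : ℝ) : ℝ := 1 - c ^ 2

/-- `s = 5 - 4c²`. -/
def sOf (c : ℝ) : ℝ := 5 - 4 * c ^ 2

/-- `β(α, c) = -4α² - 4α + 3 + 16r`. -/
def betaOf (α c : ℝ) : ℝ := -4 * α ^ 2 - 4 * α + 3 + 16 * rOf c

/-- The negative root `α₁`. -/
def alpha1 (α c : ℝ) : ℝ := (-2 * α - 3 - √3 * √(betaOf α c)) / 4

/-- The intermediate root `α₃`. -/
def alpha3 (α c : ℝ) : ℝ := (-2 * α - 3 + √3 * √(betaOf α c)) / 4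

/-- The square `k²` of the elliptic modulus, as a function of `α₄` and `c`. -/
def modulusSq (α c : ℝ) : ℝ :=
  (6 * α ^ 2 + 9 * α - 12 * rOf c + α * √3 * √(betaOf α c)) / (2 * √3 * α * √(betaOf α c))

/-- The elliptic modulus `k`. -/
def modulus (α c : ℝ) : ℝ := √(modulusSq α c)

/-- The open interval of admissible values of `α₄` at speed `c`. -/
def admissible (c : ℝ) : Set ℝ :=
  Ioo ((-1 + √(1 + 4 * rOf c)) / 2) ((-3 + √(9 + 48 * rOf c)) / 4)

/-- The period map `T(α₄, c)`. -/
def periodMap (α c : ℝ) : ℝ :=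
  2 * √(2 * √3 * sOf c) * ellipticK (modulus α c) / √(α * √(betaOf α c))

/-- `g = 2 / √(α₄ (α₃ - α₁))`. -/
def gOf (α c : ℝ) : ℝ := 2 / √(α * (alpha3 α c - alpha1 α c))

/-- The coefficient `(α₄ / (-α₁)) k²` of `sn²` in the denominator of the profile. -/
def snCoeff (α c : ℝ) : ℝ := α / (-alpha1 α c) * modulusSq α c

/-- The dnoidal profile `φ(x)` with parameters `α₄` and `c`. -/
def profile (α c x : ℝ) : ℝ :=
  √α * jacobiDn (2 / (gOf α c * √(3 * sOf c)) * x) (modulus α c) /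
    √(1 + snCoeff α c * jacobiSn (2 / (gOf α c * √(3 * sOf c)) * x) (modulus α c) ^ 2)

/-- The upper end of the interval of wave speeds,
`½ √(5 - L⁴ / (L² - 4π²)²)`. -/
def speedBound (L : ℝ) : ℝ := 1 / 2 * √(5 - L ^ 4 / (L ^ 2 - 4 * π ^ 2) ^ 2)

/-- `L` is the fundamental (smallest positive) period of `f`. -/
def IsFundamentalPeriod (f : ℝ → ℝ) (L : ℝ) : Prop :=
  0 < L ∧ Function.Periodic f L ∧ ∀ T, 0 < T → T < L → ¬ Function.Periodic f T

/-- `φ` is a classical solution of `-φ'' + (r/s) φ - (1/s)(φ³ + φ⁵) = 0`. -/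
def SolvesProfileEq (c : ℝ) (φ : ℝ → ℝ) : Prop :=
  ContDiff ℝ 2 φ ∧ ∀ x, -iteratedDeriv 2 φ x + rOf c / sOf c * φ x
    - 1 / sOf c * (φ x ^ 3 + φ x ^ 5) = 0

/-! ### The periodic Sobolev spaces `Hⁿ_per([0, L])` -/

section Sobolev

variable (L : ℝ) [Fact (0 < L)] (n : ℕ)

/-- The sequence `√(L (1 + |k|²)ⁿ) f̂(k)`, where `f̂(k) = (1/L) ∫₀ᴸ f(x) e^{-2πikx/L} dx`. -/
def weightedCoeff (f : Lp ℂ 2 (AddCircle.haarAddCircle (T := L))) (k : ℤ) : ℂ :=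
  ((√(L * (1 + (k : ℝ) ^ 2) ^ n) : ℝ) : ℂ) * fourierCoeff f k

theorem weightedCoeff_add (f g : Lp ℂ 2 (AddCircle.haarAddCircle (T := L))) :
    weightedCoeff L n (f + g) = weightedCoeff L n f + weightedCoeff L n g := by
  funext k
  simp only [weightedCoeff, Pi.add_apply, ← fourierBasis_repr, map_add, lp.coeFn_add]
  ring

theorem weightedCoeff_smul (a : ℂ) (f : Lp ℂ 2 (AddCircle.haarAddCircle (T := L))) :
    weightedCoeff L n (a • f) = a • weightedCoeff L n f := by
  funext k
  simp only [weightedCoeff, Pi.smul_apply, ← fourierBasis_repr, map_smul, lp.coeFn_smul,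
    smul_eq_mul]
  ring

theorem weightedCoeff_zero :
    weightedCoeff L n (0 : Lp ℂ 2 (AddCircle.haarAddCircle (T := L))) = 0 := by
  simpa using weightedCoeff_smul L n 0 0

theorem norm_weightedCoeff_sq (f : Lp ℂ 2 (AddCircle.haarAddCircle (T := L))) (k : ℤ) :
    ‖weightedCoeff L n f k‖ ^ 2 = L * (1 + (k : ℝ) ^ 2) ^ n * ‖fourierCoeff f k‖ ^ 2 := by
  have hL : 0 < L := Fact.out
  rw [weightedCoeff, norm_mul, mul_pow, Complex.norm_real, Real.norm_eq_abs, sq_abs,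
    Real.sq_sqrt (by positivity)]

theorem memlp_weightedCoeff_iff (f : Lp ℂ 2 (AddCircle.haarAddCircle (T := L))) :
    Memℓp (weightedCoeff L n f) 2 ↔
      Summable fun k : ℤ => L * (1 + (k : ℝ) ^ 2) ^ n * ‖fourierCoeff f k‖ ^ 2 := by
  rw [memℓp_gen_iff (by norm_num)]
  simp only [ENNReal.toReal_ofNat, Real.rpow_ofNat, norm_weightedCoeff_sq]

/-- The subspace of all `f ∈ L²_per` with `L ∑ₖ (1 + |k|²)ⁿ |f̂(k)|² < ∞`. -/
def perSobolevSubmodule : Submodule ℂ (Lp ℂ 2 (AddCircle.haarAddCircle (T := L))) where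
  carrier := {f | Summable fun k : ℤ => L * (1 + (k : ℝ) ^ 2) ^ n * ‖fourierCoeff f k‖ ^ 2}
  add_mem' := by
    intro f g hf hg
    rw [Set.mem_ofPred_eq, ← memlp_weightedCoeff_iff] at *
    rw [weightedCoeff_add]
    exact hf.add hg
  zero_mem' := by
    rw [Set.mem_ofPred_eq, ← memlp_weightedCoeff_iff, weightedCoeff_zero]
    exact zero_memℓp
  smul_mem' := by
    intro a f hf
    rw [Set.mem_ofPred_eq, ← memlp_weightedCoeff_iff] at *
    rw [weightedCoeff_smul]
    exact hf.const_smul a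

/-- The periodic Sobolev space `Hⁿ_per([0, L])`. It is a separate type, so that it does not
inherit the norm of `L²`; its norm is `‖f‖² = L ∑ₖ (1 + |k|²)ⁿ |f̂(k)|²`. -/
def PerSobolev : Type := perSobolevSubmodule L n

instance : AddCommGroup (PerSobolev L n) :=
  inferInstanceAs (AddCommGroup (perSobolevSubmodule L n))

instance : Module ℂ (PerSobolev L n) :=
  inferInstanceAs (Module ℂ (perSobolevSubmodule L n))

variable {L n} in
/-- The underlying element of `L²_per`. -/
def PerSobolev.toL2 (f : PerSobolev L n) : Lp ℂ 2 (AddCircle.haarAddCircle (T := L)) :=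
  Subtype.val (p := fun f => f ∈ perSobolevSubmodule L n) f

/-- The linear embedding of `Hⁿ_per` into `ℓ²(ℤ)` which defines its norm. -/
def PerSobolev.embed : PerSobolev L n →ₗ[ℂ] lp (fun _ : ℤ => ℂ) 2 where
  toFun f := ⟨weightedCoeff L n f.toL2, (memlp_weightedCoeff_iff L n _).2 f.2⟩
  map_add' f g := Subtype.ext (weightedCoeff_add L n f.toL2 g.toL2)
  map_smul' a f := Subtype.ext (weightedCoeff_smul L n a f.toL2)

theorem PerSobolev.embed_injective : Function.Injective (PerSobolev.embed L n) := by
  have hL : 0 < L := Fact.out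
  intro f g h
  have h1 : weightedCoeff L n f.toL2 = weightedCoeff L n g.toL2 := congrArg Subtype.val h
  have h2 : f.toL2 = g.toL2 := by
    apply (fourierBasis (T := L)).repr.injective
    apply lp.ext
    funext k
    have h3 := congrFun h1 k
    have h4 : ((√(L * (1 + (k : ℝ) ^ 2) ^ n) : ℝ) : ℂ) ≠ 0 :=
      Complex.ofReal_ne_zero.2 (Real.sqrt_ne_zero'.2 (by positivity))
    rw [fourierBasis_repr, fourierBasis_repr]
    exact mul_left_cancel₀ h4 h3
  exact Subtype.ext h2

instance : NormedAddCommGroup (PerSobolev L n) :=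
  NormedAddCommGroup.induced _ _ (PerSobolev.embed L n) (PerSobolev.embed_injective L n)

instance : NormedSpace ℂ (PerSobolev L n) :=
  NormedSpace.induced ℂ (PerSobolev L n) (lp (fun _ : ℤ => ℂ) 2) (PerSobolev.embed L n)

theorem PerSobolev.norm_sq (f : PerSobolev L n) :
    ‖f‖ ^ 2 = ∑' k : ℤ, L * (1 + (k : ℝ) ^ 2) ^ n * ‖fourierCoeff f.toL2 k‖ ^ 2 := by
  have h : ‖PerSobolev.embed L n f‖ ^ 2 = ∑' k : ℤ, ‖PerSobolev.embed L n f k‖ ^ 2 := by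
    have := lp.norm_rpow_eq_tsum (p := 2) (by norm_num) (PerSobolev.embed L n f)
    simpa using this
  refine Eq.trans h (tsum_congr fun k => norm_weightedCoeff_sq L n f.toL2 k)

variable {L n} in
/-- `f ∈ Hⁿ_per` is the class of the function `u` on the line: for almost every point of the
circle `ℝ / Lℤ`, `f` takes there the value of `u` at all representatives of the point. -/
def PerSobolev.IsClassOf (f : PerSobolev L n) (u : ℝ → ℝ) : Prop :=
  ∀ᵐ t ∂(AddCircle.haarAddCircle (T := L)), ∀ x : ℝ, (x : AddCircle L) = t → f.toL2 t = (u x : ℂ)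

end Sobolev

end CubicQuintic

end

/-! Multiplying the profile equation by `φ'` and integrating gives `3sφ'²` as a cubic in `φ²`, with
roots `α₁ < 0 < α₃ < α₄`, sum `-3/2` and second symmetric function `-3r`. Everything is expressed
through these roots. With `G(P, Q) = ∫₀^{π/2} dθ / √(P cos² θ + Q sin² θ)` the period map becomes `T
= 2√(3s) G(P, Q)`, where `P = α₄(α₃ - α₁)` and `Q = α₃(α₄ - α₁)` (`WeaklyAdmissible.periodMap_eq`).

The crux is that `T` increases with `α₄`. `G` decreases in each argument, but `P` itself increases
near the lower end of `J_c`, so this form is not enough. Gauss's identity `G(a², b²) = G(((a +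
b)/2)², ab)` (`gaussIntegral_agm`) makes the arguments symmetric in `P` and `Q`; by Vieta they are
then increasing functions of `p = α₃ + α₄` alone, and `p` decreases in `α₄`
(`hasDerivAt_periodMap`).

At the lower end `P = Q` and `T` tends to the period of the linearization, which is below `L` for
`|c| < c_L`; at the upper end `Q → 0` and `G` diverges logarithmically. The intermediate value
theorem yields `Λ(c)`, the implicit function theorem its smoothness. Since for `α > 0` the condition
`k² ∈ (0, 1)` means `α ∈ J_c`, one can take `I₂ = (0, ∞)`.

The equation and the fundamental period follow from `am' = dn` and from the zeros of `sn`. For the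
Sobolev statement, a jointly smooth periodic family is a smooth curve in `C(ℝ/Lℤ)`
(`contDiffOn_curry`). Applying `(1 - (L/2π)²∂²)ⁿ` to the family and then the bounded inverse `L² →
Hⁿ` gives the curve in `Hⁿ`. -/

namespace CubicQuintic

/-! ### Smooth families as smooth maps into spaces of continuous functions -/

section Curry

universe u

open Filter Topology

variable {E : Type*} [NormedAddCommGroup E] [NormedSpace ℝ E]

/-- Exchange of the order of the arguments, from `C(X, E →L F)` to `E →L C(X, F)`. -/
noncomputable def flipCurry (X E F : Type*) [TopologicalSpace X] [CompactSpace X]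
    [NormedAddCommGroup E] [NormedSpace ℝ E] [NormedAddCommGroup F] [NormedSpace ℝ F] :
    C(X, E →L[ℝ] F) →L[ℝ] E →L[ℝ] C(X, F) :=
  LinearMap.mkContinuous₂
    (LinearMap.mk₂ ℝ (fun (g : C(X, E →L[ℝ] F)) (v : E) => (⟨fun x => g x v, by fun_prop⟩ : C(X, F)))
      (fun _ _ _ => by ext; simp) (fun _ _ _ => by ext; simp)
      (fun _ _ _ => by ext; simp) (fun _ _ _ => by ext; simp)) 1 (by
    intro g v
    rw [one_mul]
    refine (ContinuousMap.norm_le _ (by positivity)).2 fun x => ?_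
    exact (ContinuousLinearMap.le_opNorm _ _).trans
      (mul_le_mul_of_nonneg_right (g.norm_coe_le_norm x) (norm_nonneg v)))

@[simp]
theorem flipCurry_apply {X F : Type*} [TopologicalSpace X] [CompactSpace X]
    [NormedAddCommGroup F] [NormedSpace ℝ F] (g : C(X, E →L[ℝ] F)) (v : E) (x : X) :
    flipCurry X E F g v x = g x v := rfl

theorem continuousOn_curry {P X F : Type*} [TopologicalSpace P] [TopologicalSpace X]
    [TopologicalSpace F] {U : Set P} {h : P → X → F}
    (hc : ContinuousOn (fun z : P × X => h z.1 z.2) (U ×ˢ univ)) {G : P → C(X, F)}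
    (hG : ∀ p ∈ U, ∀ x, G p x = h p x) : ContinuousOn G U := by
  rw [continuousOn_iff_continuous_domRestrict]
  have h1 : Continuous fun z : U × X => h z.1 z.2 :=
    hc.comp_continuous (f := fun z : U × X => ((z.1 : P), z.2)) (by fun_prop)
      (fun z => ⟨z.1.2, mem_univ _⟩)
  convert (ContinuousMap.curry ⟨_, h1⟩).continuous using 1
  ext p x
  exact hG p p.2 x

/-- Sup-norm continuity of `G'` keeps all the derivatives within `ε` of their values at `p` on one
ball, whatever `x` is. The mean value inequality there bounds the remainder uniformly in `x`. -/
theorem hasFDerivAt_curry {X F : Type*} [TopologicalSpace X] [CompactSpace X]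
    [NormedAddCommGroup F] [NormedSpace ℝ F] {U : Set E} (hU : IsOpen U)
    {h : E → X → F} {h' : E → X → E →L[ℝ] F}
    (hd : ∀ p ∈ U, ∀ x, HasFDerivAt (fun q => h q x) (h' p x) p)
    {G : E → C(X, F)} (hG : ∀ p ∈ U, ∀ x, G p x = h p x)
    {G' : E → C(X, E →L[ℝ] F)} (hG' : ∀ p ∈ U, ∀ x, G' p x = h' p x)
    (hc : ContinuousOn G' U) {p : E} (hp : p ∈ U) :
    HasFDerivAt G (flipCurry X E F (G' p)) p := by
  rw [hasFDerivAt_iff_isLittleO, Asymptotics.isLittleO_iff]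
  intro ε hε
  have h1 : ∀ᶠ q in 𝓝 p, q ∈ U ∧ dist (G' q) (G' p) < ε :=
    Filter.Eventually.and (hU.mem_nhds hp)
      (Metric.continuousAt_iff'.1 (hc.continuousAt (hU.mem_nhds hp)) ε hε)
  obtain ⟨δ, hδ, hb⟩ := Metric.eventually_nhds_iff_ball.1 h1
  filter_upwards [Metric.ball_mem_nhds p hδ] with q hq
  refine (ContinuousMap.norm_le _ (by positivity)).2 fun x => ?_
  have h2 := (convex_ball p δ).norm_image_sub_le_of_norm_hasFDerivWithin_le'
    (f := fun q => h q x) (f' := fun q => h' q x) (φ := h' p x) (C := ε)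
    (fun y hy => (hd y (hb y hy).1 x).hasFDerivWithinAt) (fun y hy => by
      rw [← hG' y (hb y hy).1, ← hG' p hp, ← dist_eq_norm]
      exact (ContinuousMap.dist_apply_le_dist x).trans (hb y hy).2.le)
    (Metric.mem_ball_self hδ) hq
  simpa [hG p hp, hG q (hb q hq).1, hG' p hp] using h2

/-- `Y` covers `X`: it is `X = [a, b]` itself for integrals, and `ℝ` over the circle for periodic
families. Openness of `q` keeps `id × q` a quotient map, so joint continuity can be tested on `E ×
Y`. -/
theorem continuousOn_family {E X Y F : Type*} [NormedAddCommGroup E] [TopologicalSpace X]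
    [TopologicalSpace Y] [TopologicalSpace F]
    {q : Y → X} (hq : IsOpenQuotientMap q) {j : Y → ℝ} (hj : Continuous j)
    {U : Set E} (hU : IsOpen U) {H : E × ℝ → F} (hH : ContinuousOn H (U ×ˢ univ)) {h : E → X → F}
    (hh : ∀ p ∈ U, ∀ y, h p (q y) = H (p, j y)) :
    ContinuousOn (fun z : E × X => h z.1 z.2) (U ×ˢ univ) := by
  rintro ⟨p, x⟩ ⟨hp, -⟩
  obtain ⟨y, rfl⟩ := hq.surjective x
  refine ContinuousAt.continuousWithinAt ?_
  have hQ : IsOpenQuotientMap (Prod.map (id : E → E) q) := IsOpenQuotientMap.id.prodMap hq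
  rw [show (p, q y) = Prod.map id q (p, y) from rfl, ← hQ.continuousAt_comp_iff]
  have h1 : ContinuousAt (fun z : E × Y => H (z.1, j z.2)) (p, y) := by
    refine ContinuousAt.comp (f := fun z : E × Y => (z.1, j z.2)) (g := H) ?_ (by fun_prop)
    exact hH.continuousAt ((hU.prod isOpen_univ).mem_nhds ⟨hp, mem_univ _⟩)
  refine h1.congr ?_
  filter_upwards [(hU.prod isOpen_univ).mem_nhds (show (p, y) ∈ U ×ˢ univ from ⟨hp, mem_univ _⟩)]
    with z hz
  exact (hh z.1 hz.1 z.2).symm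

/-- The derivative of a curried family is the curried partial derivative, a family of the same kind
with values in `E →L[ℝ] F`. Hence the induction is over all `F` at once, with `E` and `F` in one
universe. -/
theorem contDiffOn_nat_curry {E : Type u} {X Y : Type*} [NormedAddCommGroup E] [NormedSpace ℝ E]
    [TopologicalSpace X] [CompactSpace X] [TopologicalSpace Y]
    {q : Y → X} (hq : IsOpenQuotientMap q) {j : Y → ℝ} (hj : Continuous j)
    {U : Set E} (hU : IsOpen U) (n : ℕ) : ∀ {F : Type u}
    [NormedAddCommGroup F] [NormedSpace ℝ F] {H : E × ℝ → F}
    (_ : ContDiffOn ℝ ∞ H (U ×ˢ univ))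
    {G : E → C(X, F)} (_ : ∀ p ∈ U, ∀ y, G p (q y) = H (p, j y)),
    ContDiffOn ℝ n G U := by
  induction n with
  | zero =>
    intro F _ _ H hH G hG
    exact contDiffOn_zero.2 (continuousOn_curry (continuousOn_family hq hj hU hH.continuousOn hG)
      fun _ _ _ => rfl)
  | succ n ih =>
    intro F _ _ H hH G hG
    set D : E × ℝ → E →L[ℝ] F := fun z => (fderiv ℝ H z).comp (ContinuousLinearMap.inl ℝ E ℝ)
      with hDdef
    have hUo := hU.prod (isOpen_univ (X := ℝ))
    have hD : ContDiffOn ℝ ∞ D (U ×ˢ univ) :=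
      (hH.fderiv_of_isOpen hUo (by simp)).clm_comp contDiffOn_const
    have hder : ∀ p ∈ U, ∀ y, HasFDerivAt (fun r => G r (q y)) (D (p, j y)) p := by
      intro p hp y
      have h1 : HasFDerivAt H (fderiv ℝ H (p, j y)) (p, j y) :=
        ((hH.contDiffAt (hUo.mem_nhds ⟨hp, mem_univ _⟩)).differentiableAt (by simp)).hasFDerivAt
      refine (h1.comp p (hasFDerivAt_prodMk_left p (j y))).congr_of_eventuallyEq ?_
      filter_upwards [hU.mem_nhds hp] with r hr
      exact hG r hr y
    -- A preimage under `q` is chosen; by uniqueness of the derivative, `hh'q` makes the choice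
    -- irrelevant.
    set h' : E → X → E →L[ℝ] F := fun p x => D (p, j (Function.surjInv hq.surjective x)) with hh'
    have hh'q : ∀ p ∈ U, ∀ y, h' p (q y) = D (p, j y) := by
      intro p hp y
      have h2 := hder p hp (Function.surjInv hq.surjective (q y))
      rw [Function.surjInv_eq hq.surjective] at h2
      exact h2.unique (hder p hp y)
    have hc' := continuousOn_family hq hj hU hD.continuousOn hh'q
    have hx : ∀ p ∈ U, Continuous (h' p) := fun p hp =>
      hc'.comp_continuous (f := fun x => (p, x)) (by fun_prop) fun x => ⟨hp, mem_univ _⟩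
    classical
    set G' : E → C(X, E →L[ℝ] F) := fun p => if hp : p ∈ U then ⟨h' p, hx p hp⟩ else 0 with hG'def
    have hG' : ∀ p ∈ U, ∀ x, G' p x = h' p x := by
      intro p hp x
      simp only [hG'def, dif_pos hp, ContinuousMap.coe_mk]
    have hG's : ContDiffOn ℝ n G' U := ih hD fun p hp y => (hG' p hp _).trans (hh'q p hp y)
    have hGd : ∀ p ∈ U, HasFDerivAt G (flipCurry X E F (G' p)) p := fun p hp =>
      hasFDerivAt_curry hU (h := fun p x => G p x) (h' := h') (fun p hp x => by
        obtain ⟨y, rfl⟩ := hq.surjective x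
        rw [hh'q p hp y]
        exact hder p hp y) (fun _ _ _ => rfl) hG' hG's.continuousOn hp
    rw [Nat.cast_add, Nat.cast_one, contDiffOn_succ_iff_fderiv_of_isOpen hU]
    refine ⟨fun p hp => (hGd p hp).differentiableAt.differentiableWithinAt, by simp, ?_⟩
    refine ((flipCurry X E F).contDiff.comp_contDiffOn hG's).congr fun p hp => ?_
    exact (hGd p hp).fderiv

/-- A family of continuous functions on a compact space `X` which is given by a smooth function
`H (p, j y)`, where `y` runs over a space `Y` above `X`, depends smoothly on the parameter. -/
theorem contDiffOn_curry {E F : Type u} {X Y : Type*} [NormedAddCommGroup E] [NormedSpace ℝ E]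
    [TopologicalSpace X] [CompactSpace X] [TopologicalSpace Y]
    {q : Y → X} (hq : IsOpenQuotientMap q) {j : Y → ℝ} (hj : Continuous j)
    [NormedAddCommGroup F] [NormedSpace ℝ F]
    {U : Set E} (hU : IsOpen U) {H : E × ℝ → F} (hH : ContDiffOn ℝ ∞ H (U ×ˢ univ))
    {G : E → C(X, F)} (hG : ∀ p ∈ U, ∀ y, G p (q y) = H (p, j y)) :
    ContDiffOn ℝ ∞ G U :=
  contDiffOn_infty.2 fun n => contDiffOn_nat_curry hq hj hU n hH hG

/-- The integral over `[a, b]` as a continuous linear functional on `C([a, b], ℝ)`. -/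
noncomputable def integralCLM {a b : ℝ} (hab : a ≤ b) : C(Icc a b, ℝ) →L[ℝ] ℝ :=
  LinearMap.mkContinuous
    { toFun := fun f => ∫ t in a..b, f (projIcc a b hab t)
      map_add' := fun f g => by
        simp only [ContinuousMap.add_apply]
        exact intervalIntegral.integral_add
          ((f.continuous.comp continuous_projIcc).intervalIntegrable _ _)
          ((g.continuous.comp continuous_projIcc).intervalIntegrable _ _)
      map_smul' := fun m f => by simp } (b - a) fun f => by
    have h := intervalIntegral.norm_integral_le_of_norm_le_const (a := a) (b := b) (C := ‖f‖)
      (f := fun t => f (projIcc a b hab t)) fun t _ => f.norm_coe_le_norm _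
    rwa [abs_of_nonneg (sub_nonneg.2 hab), mul_comm] at h

theorem integralCLM_apply {a b : ℝ} (hab : a ≤ b) (f : C(Icc a b, ℝ)) :
    integralCLM hab f = ∫ t in a..b, f (projIcc a b hab t) := rfl

theorem integralCLM_eq {a b : ℝ} (hab : a ≤ b) (f : C(Icc a b, ℝ)) {g : ℝ → ℝ}
    (h : ∀ t : Icc a b, f t = g t) : integralCLM hab f = ∫ t in a..b, g t := by
  rw [integralCLM_apply]
  refine intervalIntegral.integral_congr fun t ht => ?_
  rw [uIcc_of_le hab] at ht
  simp only [h, projIcc_of_mem hab ht]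

theorem exists_continuousMap_slice {E : Type*} [NormedAddCommGroup E] {F : Type*}
    [TopologicalSpace F] [Inhabited F] {U : Set E} {H : E × ℝ → F}
    (hH : ContinuousOn H (U ×ˢ univ)) (a b : ℝ) :
    ∃ G : E → C(Icc a b, F), ∀ p ∈ U, ∀ t : Icc a b, G p t = H (p, t) := by
  classical
  have hx : ∀ p ∈ U, Continuous fun t : Icc a b => H (p, t) := fun p hp =>
    hH.comp_continuous (f := fun t : Icc a b => (p, (t : ℝ))) (by fun_prop)
      fun t => ⟨hp, mem_univ _⟩
  refine ⟨fun p => if hp : p ∈ U then ⟨_, hx p hp⟩ else ContinuousMap.const _ default, ?_⟩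
  intro p hp t
  simp only [dif_pos hp, ContinuousMap.coe_mk]

/-- Integrals of smooth functions depend smoothly on the parameters. -/
theorem contDiffOn_parametric_integral {E : Type} [NormedAddCommGroup E] [NormedSpace ℝ E]
    {U : Set E} (hU : IsOpen U) {H : E × ℝ → ℝ} (hH : ContDiffOn ℝ ∞ H (U ×ˢ univ))
    {a b : ℝ} (hab : a ≤ b) : ContDiffOn ℝ ∞ (fun p => ∫ t in a..b, H (p, t)) U := by
  obtain ⟨G, hG⟩ := exists_continuousMap_slice hH.continuousOn a b
  have hs := contDiffOn_curry IsOpenQuotientMap.id (j := (Subtype.val : Icc a b → ℝ))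
    continuous_subtype_val hU hH hG
  refine ((integralCLM hab).contDiff.comp_contDiffOn hs).congr fun p hp => ?_
  exact (integralCLM_eq hab (G p) (g := fun t => H (p, t)) (hG p hp)).symm

theorem hasDerivAt_parametric_integral {U : Set ℝ} (hU : IsOpen U) {H H' : ℝ × ℝ → ℝ}
    (hH : ContinuousOn H (U ×ˢ univ)) (hH' : ContinuousOn H' (U ×ˢ univ))
    (hd : ∀ y ∈ U, ∀ t, HasDerivAt (fun z => H (z, t)) (H' (y, t)) y)
    {a b : ℝ} (hab : a ≤ b) {y : ℝ} (hy : y ∈ U) :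
    HasDerivAt (fun z => ∫ t in a..b, H (z, t)) (∫ t in a..b, H' (y, t)) y := by
  obtain ⟨G, hG⟩ := exists_continuousMap_slice hH a b
  have hD : ContinuousOn (fun z => ContinuousLinearMap.toSpanSingleton ℝ (H' z)) (U ×ˢ univ) :=
    ((ContinuousLinearMap.toSpanSingletonCLE (𝕜 := ℝ) (E := ℝ)).continuous.comp_continuousOn hH')
  obtain ⟨G', hG'⟩ := exists_continuousMap_slice hD a b
  have hc : ContinuousOn G' U := continuousOn_curry
    (continuousOn_family IsOpenQuotientMap.id (j := (Subtype.val : Icc a b → ℝ))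
      continuous_subtype_val hU hD (h := fun p t => ContinuousLinearMap.toSpanSingleton ℝ (H' (p, t)))
      fun _ _ _ => rfl) hG'
  have h1 := hasFDerivAt_curry hU
    (fun p hp (x : Icc a b) => (hd p hp x).hasFDerivAt) hG hG' hc hy
  have h2 := ((integralCLM hab).hasFDerivAt.comp y h1).hasDerivAt
  have h3 : HasDerivAt (fun z => ∫ t in a..b, H (z, t)) _ y := h2.congr_of_eventuallyEq (by
    filter_upwards [hU.mem_nhds hy] with z hz
    exact (integralCLM_eq hab (G z) (g := fun t => H (z, t)) (hG z hz)).symm)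
  convert h3 using 1
  refine (integralCLM_eq hab _ (g := fun t => H' (y, t)) fun t => ?_).symm
  simp [hG' y hy]

/-- A function which is locally the unique solution of a smooth equation is smooth. -/
theorem contDiffAt_of_implicit {E : Type*} [NormedAddCommGroup E] [NormedSpace ℝ E]
    [CompleteSpace E] {f : E × ℝ → ℝ} {g : E → ℝ} {p : E} {d l : ℝ}
    (hf : ContDiffAt ℝ ∞ f (p, g p)) (hd : HasDerivAt (fun y => f (p, y)) d (g p)) (hd0 : d ≠ 0)
    (hp : f (p, g p) = l) (hu : ∀ᶠ z in 𝓝 (p, g p), f z = l → z.2 = g z.1) :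
    ContDiffAt ℝ ∞ g p := by
  have h1 : HasFDerivAt f (fderiv ℝ f (p, g p)) (p, g p) :=
    (hf.differentiableAt (by simp)).hasFDerivAt
  have h2 : (fderiv ℝ f (p, g p)).comp (ContinuousLinearMap.inr ℝ E ℝ) =
      ContinuousLinearMap.toSpanSingleton ℝ d :=
    (h1.comp (g p) (hasFDerivAt_prodMk_right p (g p))).unique hd.hasFDerivAt
  have hinv : (fderiv ℝ f (p, g p) ∘L .inr ℝ E ℝ).IsInvertible := by
    rw [h2]
    refine ⟨ContinuousLinearEquiv.unitsEquivAut ℝ (Units.mk0 d hd0), ?_⟩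
    ext
    simp
  have hψ := hf.contDiffAt_implicitFunction (by simp) hinv
  refine hψ.congr_of_eventuallyEq ?_
  have ht : Tendsto (fun x => (x, hf.implicitFunction (by simp) hinv x)) (𝓝 p) (𝓝 (p, g p)) := by
    have := (continuousAt_id.prodMk hψ.continuousAt).tendsto
    rwa [hf.implicitFunction_apply_self (by simp) hinv] at this
  filter_upwards [hf.eventually_apply_implicitFunction (by simp) hinv, ht.eventually hu] with x h3 h4
  exact (h4 (h3.trans hp)).symm

end Curry

/-! ### Smooth curves in periodic Sobolev spaces -/

section SobolevSmooth

open Filter Topology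

/-- The operator `1 - (L / 2π)² ∂²` in the second variable. -/
noncomputable def bessel (L : ℝ) (H : ℝ × ℝ → ℂ) (z : ℝ × ℝ) : ℂ :=
  H z - ((L / (2 * π)) ^ 2 : ℝ) • fderiv ℝ (fun w => fderiv ℝ H w (0, 1)) z (0, 1)

theorem contDiffOn_fderiv_snd {U : Set ℝ} (hU : IsOpen U) {H : ℝ × ℝ → ℂ}
    (hH : ContDiffOn ℝ ∞ H (U ×ˢ univ)) :
    ContDiffOn ℝ ∞ (fun w => fderiv ℝ H w (0, 1)) (U ×ˢ univ) :=
  (hH.fderiv_of_isOpen (hU.prod isOpen_univ) (by simp)).clm_apply contDiffOn_const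

theorem hasDerivAt_snd {U : Set ℝ} (hU : IsOpen U) {H : ℝ × ℝ → ℂ}
    (hH : ContDiffOn ℝ ∞ H (U ×ˢ univ)) {c : ℝ} (hc : c ∈ U) (y : ℝ) :
    HasDerivAt (fun x => H (c, x)) (fderiv ℝ H (c, y) (0, 1)) y := by
  have h1 : HasFDerivAt H (fderiv ℝ H (c, y)) (c, y) :=
    ((hH.contDiffAt ((hU.prod isOpen_univ).mem_nhds ⟨hc, mem_univ _⟩)).differentiableAt
      (by simp)).hasFDerivAt
  exact h1.comp_hasDerivAt y ((hasDerivAt_const y c).prodMk (hasDerivAt_id y))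

theorem periodic_fderiv_snd {L : ℝ} {U : Set ℝ} (hU : IsOpen U) {H : ℝ × ℝ → ℂ}
    (hH : ContDiffOn ℝ ∞ H (U ×ˢ univ)) {c : ℝ} (hc : c ∈ U)
    (hp : Function.Periodic (fun y => H (c, y)) L) :
    Function.Periodic (fun y => fderiv ℝ H (c, y) (0, 1)) L := by
  intro y
  have h1 := (hasDerivAt_snd hU hH hc (y + L)).comp_add_const y L
  have h2 : (fun x => H (c, x + L)) = fun x => H (c, x) := funext hp
  rw [h2] at h1
  exact h1.unique (hasDerivAt_snd hU hH hc y)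

theorem contDiffOn_bessel {L : ℝ} {U : Set ℝ} (hU : IsOpen U) {H : ℝ × ℝ → ℂ}
    (hH : ContDiffOn ℝ ∞ H (U ×ˢ univ)) : ContDiffOn ℝ ∞ (bessel L H) (U ×ˢ univ) :=
  hH.sub ((contDiffOn_fderiv_snd hU (contDiffOn_fderiv_snd hU hH)).const_smul _)

theorem periodic_bessel {L : ℝ} {U : Set ℝ} (hU : IsOpen U) {H : ℝ × ℝ → ℂ}
    (hH : ContDiffOn ℝ ∞ H (U ×ˢ univ)) {c : ℝ} (hc : c ∈ U)
    (hp : Function.Periodic (fun y => H (c, y)) L) :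
    Function.Periodic (fun y => bessel L H (c, y)) L := by
  intro y
  have h1 := periodic_fderiv_snd hU (contDiffOn_fderiv_snd hU hH) hc
    (periodic_fderiv_snd hU hH hc hp) y
  have h2 := hp y
  simp only [bessel] at h1 h2 ⊢
  rw [h1, h2]

variable {L : ℝ} [Fact (0 < L)] {n : ℕ}

theorem lp_ext_fourierCoeff {f g : Lp ℂ 2 (AddCircle.haarAddCircle (T := L))}
    (h : ∀ k, fourierCoeff f k = fourierCoeff g k) : f = g := by
  apply (fourierBasis (T := L)).repr.injective
  apply lp.ext
  funext k
  rw [fourierBasis_repr, fourierBasis_repr, h]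

theorem PerSobolev.ext_fourierCoeff {f g : PerSobolev L n}
    (h : ∀ k, fourierCoeff f.toL2 k = fourierCoeff g.toL2 k) : f = g :=
  Subtype.ext (lp_ext_fourierCoeff h)

theorem PerSobolev.toL2_add (f g : PerSobolev L n) : (f + g).toL2 = f.toL2 + g.toL2 := rfl

theorem PerSobolev.toL2_smul (a : ℂ) (f : PerSobolev L n) : (a • f).toL2 = a • f.toL2 := rfl

theorem fourierCoeff_lp_add (f g : Lp ℂ 2 (AddCircle.haarAddCircle (T := L))) (k : ℤ) :
    fourierCoeff (f + g : Lp ℂ 2 (AddCircle.haarAddCircle (T := L))) k =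
      fourierCoeff f k + fourierCoeff g k := by
  simp only [← fourierBasis_repr, map_add, lp.coeFn_add, Pi.add_apply]

theorem fourierCoeff_lp_smul (a : ℂ) (f : Lp ℂ 2 (AddCircle.haarAddCircle (T := L))) (k : ℤ) :
    fourierCoeff (a • f : Lp ℂ 2 (AddCircle.haarAddCircle (T := L))) k =
      a * fourierCoeff f k := by
  simp only [← fourierBasis_repr, map_smul, lp.coeFn_smul, Pi.smul_apply, smul_eq_mul]

theorem hasSum_sq_fourierCoeff_norm (f : Lp ℂ 2 (AddCircle.haarAddCircle (T := L))) :
    HasSum (fun k => ‖fourierCoeff f k‖ ^ 2) (‖f‖ ^ 2) := by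
  have h := lp.hasSum_norm (p := 2) (by norm_num) ((fourierBasis (T := L)).repr f)
  simp only [LinearIsometryEquiv.norm_map, fourierBasis_repr] at h
  simpa using h

/-- An `L²` function with given Fourier coefficients, dominated by those of `f`. -/
theorem exists_lp_fourierCoeff (f : Lp ℂ 2 (AddCircle.haarAddCircle (T := L))) (n : ℕ) :
    ∃ g : Lp ℂ 2 (AddCircle.haarAddCircle (T := L)),
      ∀ k, fourierCoeff g k = fourierCoeff f k / (1 + (k : ℂ) ^ 2) ^ n := by
  have h : Memℓp (fun k : ℤ => fourierCoeff f k / (1 + (k : ℂ) ^ 2) ^ n) 2 := by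
    rw [memℓp_gen_iff (by norm_num)]
    simp only [ENNReal.toReal_ofNat, Real.rpow_ofNat]
    refine Summable.of_nonneg_of_le (fun k => by positivity) (fun k => ?_)
      (hasSum_sq_fourierCoeff_norm f).summable
    rw [norm_div, div_pow]
    refine div_le_self (by positivity) ?_
    have h1 : (1 + (k : ℂ) ^ 2) ^ n = (((1 + (k : ℝ) ^ 2) ^ n : ℝ) : ℂ) := by push_cast; rfl
    rw [h1, Complex.norm_real, Real.norm_of_nonneg (by positivity)]
    exact one_le_pow₀ (one_le_pow₀ (by nlinarith [sq_nonneg (k : ℝ)]))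
  refine ⟨(fourierBasis (T := L)).repr.symm ⟨_, h⟩, fun k => ?_⟩
  rw [← fourierBasis_repr, LinearIsometryEquiv.apply_symm_apply]

/-- Division by `(1 + k²)ⁿ` puts `(1 + k²)⁻²ⁿ` into the square, which more than absorbs the weight
`(1 + k²)ⁿ`. -/
theorem term_smoothing (a : ℂ) (k : ℤ) :
    L * (1 + (k : ℝ) ^ 2) ^ n * ‖a / (1 + (k : ℂ) ^ 2) ^ n‖ ^ 2 ≤ L * ‖a‖ ^ 2 := by
  have hL : 0 < L := Fact.out
  have h1 : (1 + (k : ℂ) ^ 2) ^ n = (((1 + (k : ℝ) ^ 2) ^ n : ℝ) : ℂ) := by push_cast; rfl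
  have h2 : 1 ≤ (1 + (k : ℝ) ^ 2) ^ n := one_le_pow₀ (by nlinarith [sq_nonneg (k : ℝ)])
  rw [h1, norm_div, Complex.norm_real, Real.norm_of_nonneg (by positivity)]
  have : L * (1 + (k : ℝ) ^ 2) ^ n * (‖a‖ / (1 + (k : ℝ) ^ 2) ^ n) ^ 2 =
      L * ‖a‖ ^ 2 / (1 + (k : ℝ) ^ 2) ^ n := by
    field_simp
  rw [this]
  exact div_le_self (by positivity) h2

variable (n) in
theorem exists_perSobolev_fourierCoeff (f : Lp ℂ 2 (AddCircle.haarAddCircle (T := L))) :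
    ∃ g : PerSobolev L n,
      ∀ k, fourierCoeff g.toL2 k = fourierCoeff f k / (1 + (k : ℂ) ^ 2) ^ n := by
  obtain ⟨g, hg⟩ := exists_lp_fourierCoeff f n
  have hs : Summable fun k : ℤ => L * (1 + (k : ℝ) ^ 2) ^ n * ‖fourierCoeff g k‖ ^ 2 := by
    refine Summable.of_nonneg_of_le (fun k => ?_) (fun k => ?_)
      ((hasSum_sq_fourierCoeff_norm f).summable.mul_left L)
    · have hL : 0 < L := Fact.out
      positivity
    · rw [hg]
      exact term_smoothing _ _
  exact ⟨(⟨g, hs⟩ : perSobolevSubmodule L n), hg⟩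

variable (L n) in
/-- The smoothing operator `(1 - (L / 2π)² ∂²)⁻ⁿ` from `L²` to `Hⁿ_per`. -/
noncomputable def smoothing :
    Lp ℂ 2 (AddCircle.haarAddCircle (T := L)) →L[ℂ] PerSobolev L n :=
  LinearMap.mkContinuous
    { toFun := fun f => (exists_perSobolev_fourierCoeff n f).choose
      map_add' := fun f g => by
        refine PerSobolev.ext_fourierCoeff fun k => ?_
        rw [PerSobolev.toL2_add, fourierCoeff_lp_add,
          (exists_perSobolev_fourierCoeff n _).choose_spec,
          (exists_perSobolev_fourierCoeff n _).choose_spec,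
          (exists_perSobolev_fourierCoeff n _).choose_spec, fourierCoeff_lp_add, add_div]
      map_smul' := fun a f => by
        refine PerSobolev.ext_fourierCoeff fun k => ?_
        rw [RingHom.id_apply, PerSobolev.toL2_smul, fourierCoeff_lp_smul,
          (exists_perSobolev_fourierCoeff n _).choose_spec,
          (exists_perSobolev_fourierCoeff n _).choose_spec,
          fourierCoeff_lp_smul, mul_div_assoc] } (√L) fun f => by
    have hL : 0 < L := Fact.out
    refine le_of_sq_le_sq ?_ (by positivity)
    rw [PerSobolev.norm_sq, mul_pow, Real.sq_sqrt hL.le]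
    refine Real.tsum_le_of_sum_le (fun k => by positivity) fun s => ?_
    rw [← (hasSum_sq_fourierCoeff_norm f).tsum_eq, ← tsum_mul_left]
    refine le_trans (Finset.sum_le_sum fun k _ => ?_)
      (((hasSum_sq_fourierCoeff_norm f).summable.mul_left L).sum_le_tsum s
        fun k _ => by positivity)
    simp only [LinearMap.coe_mk, AddHom.coe_mk]
    rw [(exists_perSobolev_fourierCoeff n _).choose_spec]
    exact term_smoothing _ _

theorem fourierCoeff_smoothing (f : Lp ℂ 2 (AddCircle.haarAddCircle (T := L))) (k : ℤ) :
    fourierCoeff (smoothing L n f).toL2 k = fourierCoeff f k / (1 + (k : ℂ) ^ 2) ^ n :=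
  (exists_perSobolev_fourierCoeff n f).choose_spec k

theorem fourierCoeff_of_hasDerivAt {f f' : C(AddCircle L, ℂ)}
    (h : ∀ y : ℝ, HasDerivAt (fun x : ℝ => f x) (f' y) y) (k : ℤ) :
    fourierCoeff f' k = 2 * π * Complex.I * k / L * fourierCoeff f k := by
  have hL : 0 < L := Fact.out
  rw [fourierCoeff_eq_intervalIntegral f' k 0, fourierCoeff_eq_intervalIntegral f k 0]
  have h1 := intervalIntegral.integral_mul_deriv_eq_deriv_mul (a := 0) (b := L)
    (u := fun x : ℝ => fourier (-k) (x : AddCircle L)) (v := fun x : ℝ => f x)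
    (u' := fun x : ℝ => -2 * π * Complex.I * k / L * fourier (-k) (x : AddCircle L))
    (v' := fun x : ℝ => f' x)
    (fun x _ => hasDerivAt_fourier_neg L k x) (fun x _ => h x)
    (Continuous.intervalIntegrable (by fun_prop) _ _)
    (Continuous.intervalIntegrable (by fun_prop) _ _)
  have hf : f ((L : ℝ) : AddCircle L) = f ((0 : ℝ) : AddCircle L) := by
    rw [AddCircle.coe_period]; rfl
  have hF : fourier (-k) ((L : ℝ) : AddCircle L) = fourier (-k) ((0 : ℝ) : AddCircle L) := by
    rw [AddCircle.coe_period]; rfl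
  rw [hf, hF, sub_self, zero_sub] at h1
  simp only [zero_add, smul_eq_mul, mul_assoc] at h1 ⊢
  rw [h1]
  simp only [← mul_assoc]
  have h2 : ∫ x in (0 : ℝ)..L, -2 * π * Complex.I * k / L * fourier (-k) (x : AddCircle L) * f x =
      (-2 * π * Complex.I * k / L) * ∫ x in (0 : ℝ)..L, fourier (-k) (x : AddCircle L) * f x := by
    rw [← intervalIntegral.integral_const_mul]
    simp only [mul_assoc]
  rw [h2, Complex.real_smul, Complex.real_smul]
  ring

variable (L) in
/-- A continuous family on the circle made from a family of periodic functions. -/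
theorem exists_circle_family {U : Set ℝ} (hU : IsOpen U) {H : ℝ × ℝ → ℂ}
    (hH : ContDiffOn ℝ ∞ H (U ×ˢ univ))
    (hp : ∀ c ∈ U, Function.Periodic (fun y => H (c, y)) L) :
    ∃ G : ℝ → C(AddCircle L, ℂ), (∀ c ∈ U, ∀ y : ℝ, G c y = H (c, y)) ∧ ContDiffOn ℝ ∞ G U := by
  classical
  have hcont : ∀ c (hc : c ∈ U), Continuous (hp c hc).lift := fun c hc =>
    continuous_quot_lift _ (hH.continuousOn.comp_continuous (f := fun y => (c, y)) (by fun_prop)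
      fun y => ⟨hc, mem_univ _⟩)
  have hG : ∀ c ∈ U, ∀ y : ℝ, (fun c => if hc : c ∈ U then
      (⟨(hp c hc).lift, hcont c hc⟩ : C(AddCircle L, ℂ)) else 0) c y = H (c, y) := by
    intro c hc y
    simp only [dif_pos hc, ContinuousMap.coe_mk]
    exact (hp c hc).lift_coe y
  exact ⟨_, hG, contDiffOn_curry QuotientAddGroup.isOpenQuotientMap_mk continuous_id hU hH hG⟩

/-- Each derivative multiplies the coefficient by `2πik/L`; the scaling `(L/2π)²` turns `-∂²` into
exactly `k²`, matching the Sobolev weight. -/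
theorem fourierCoeff_bessel {U : Set ℝ} (hU : IsOpen U) {H : ℝ × ℝ → ℂ}
    (hH : ContDiffOn ℝ ∞ H (U ×ˢ univ))
    (hp : ∀ c ∈ U, Function.Periodic (fun y => H (c, y)) L) {c : ℝ} (hc : c ∈ U)
    {f g : C(AddCircle L, ℂ)} (hf : ∀ y : ℝ, f y = H (c, y))
    (hg : ∀ y : ℝ, g y = bessel L H (c, y)) (k : ℤ) :
    fourierCoeff g k = (1 + (k : ℂ) ^ 2) * fourierCoeff f k := by
  have hL : (L : ℂ) ≠ 0 := Complex.ofReal_ne_zero.2 (Fact.out : 0 < L).ne'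
  have hH1 := contDiffOn_fderiv_snd hU hH
  have hp1 := fun c hc => periodic_fderiv_snd hU hH hc (hp c hc)
  have hH2 := contDiffOn_fderiv_snd hU hH1
  have hp2 := fun c hc => periodic_fderiv_snd hU hH1 hc (hp1 c hc)
  obtain ⟨G1, hG1, -⟩ := exists_circle_family L hU hH1 hp1
  obtain ⟨G2, hG2, -⟩ := exists_circle_family L hU hH2 hp2
  have e1 := fourierCoeff_of_hasDerivAt (f := f) (f' := G1 c) (fun y => by
    simp only [hf, hG1 c hc]
    exact hasDerivAt_snd hU hH hc y) k
  have e2 := fourierCoeff_of_hasDerivAt (f := G1 c) (f' := G2 c) (fun y => by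
    simp only [hG1 c hc, hG2 c hc]
    exact hasDerivAt_snd hU hH1 hc y) k
  have e3 : g = f + (-((L / (2 * π)) ^ 2 : ℝ) : ℂ) • G2 c := by
    ext x
    obtain ⟨y, rfl⟩ := QuotientAddGroup.mk_surjective x
    have h1 := hf y
    have h2 := hg y
    have h3 := hG2 c hc y
    simp only [ContinuousMap.add_apply, ContinuousMap.smul_apply, smul_eq_mul]
    refine h2.trans ?_
    rw [bessel, ← h1, ← h3, Complex.real_smul]
    ring_nf
  have hint : ∀ h : C(AddCircle L, ℂ), Integrable h AddCircle.haarAddCircle := fun h =>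
    h.continuous.integrable_of_hasCompactSupport (HasCompactSupport.of_compactSpace _)
  rw [e3, ContinuousMap.coe_add, ContinuousMap.coe_smul,
    fourierCoeff.add (hint f) ((hint (G2 c)).smul _), Pi.add_apply, fourierCoeff.const_smul, e2, e1]
  have hpi : (π : ℂ) ≠ 0 := Complex.ofReal_ne_zero.2 pi_ne_zero
  push_cast
  rw [smul_eq_mul]
  field_simp
  rw [Complex.I_sq]
  ring

/-- A smooth family of smooth periodic functions is smooth with values in every periodic Sobolev
space. -/
theorem exists_contDiffOn_perSobolev (n : ℕ) {U : Set ℝ} (hU : IsOpen U) {u : ℝ → ℝ → ℝ}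
    (hu : ContDiffOn ℝ ∞ (fun z : ℝ × ℝ => u z.1 z.2) (U ×ˢ univ))
    (hper : ∀ c ∈ U, Function.Periodic (u c) L) :
    ∃ Φ : ℝ → PerSobolev L n, (∀ c ∈ U, (Φ c).IsClassOf (u c)) ∧ ContDiffOn ℝ ∞ Φ U := by
  have hH0 : ContDiffOn ℝ ∞ (fun z : ℝ × ℝ => (u z.1 z.2 : ℂ)) (U ×ˢ univ) :=
    Complex.ofRealCLM.contDiff.comp_contDiffOn hu
  have hp0 : ∀ c ∈ U, Function.Periodic (fun y => (u c y : ℂ)) L := fun c hc y =>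
    congrArg _ (hper c hc y)
  obtain ⟨G0, hG0, -⟩ := exists_circle_family L hU hH0 hp0
  -- `H` is the `m`-fold `bessel` operator applied to `u`, recorded only through its Fourier
  -- coefficients.
  have key : ∀ m : ℕ, ∃ H : ℝ × ℝ → ℂ, ContDiffOn ℝ ∞ H (U ×ˢ univ) ∧
      (∀ c ∈ U, Function.Periodic (fun y => H (c, y)) L) ∧
      ∀ c ∈ U, ∀ f : C(AddCircle L, ℂ), (∀ y : ℝ, f y = H (c, y)) → ∀ k,
        fourierCoeff f k = (1 + (k : ℂ) ^ 2) ^ m * fourierCoeff (G0 c) k := by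
    intro m
    induction m with
    | zero =>
      refine ⟨_, hH0, hp0, fun c hc f hf k => ?_⟩
      have : f = G0 c := by
        ext x
        obtain ⟨y, rfl⟩ := QuotientAddGroup.mk_surjective x
        exact (hf y).trans (hG0 c hc y).symm
      rw [this, pow_zero, one_mul]
    | succ m ih =>
      obtain ⟨H, hH, hp, hk⟩ := ih
      refine ⟨bessel L H, contDiffOn_bessel hU hH, fun c hc => periodic_bessel hU hH hc (hp c hc),
        fun c hc f hf k => ?_⟩
      obtain ⟨G, hG, -⟩ := exists_circle_family L hU hH hp
      rw [fourierCoeff_bessel hU hH hp hc (hG c hc) hf, hk c hc _ (hG c hc), pow_succ]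
      ring
  obtain ⟨H, hH, hp, hk⟩ := key n
  obtain ⟨G, hG, hGs⟩ := exists_circle_family L hU hH hp
  -- `smoothing` undoes the `n` Bessel operators. Since `S` is continuous and linear, `c ↦ S (G c)`
  -- is as smooth as `G`.
  let S := (smoothing L n).comp (ContinuousMap.toLp (E := ℂ) 2 AddCircle.haarAddCircle ℂ)
  refine ⟨fun c => S (G c), fun c hc => ?_, (S.restrictScalars ℝ).contDiff.comp_contDiffOn hGs⟩
  have e : (S (G c)).toL2 = ContinuousMap.toLp (E := ℂ) 2 AddCircle.haarAddCircle ℂ (G0 c) := by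
    refine lp_ext_fourierCoeff fun k => ?_
    have h0 : (1 + (k : ℂ) ^ 2) ^ n ≠ 0 := by
      refine pow_ne_zero _ ?_
      have : ((1 + (k : ℝ) ^ 2 : ℝ) : ℂ) ≠ 0 := Complex.ofReal_ne_zero.2 (by positivity)
      simpa using this
    rw [ContinuousLinearMap.comp_apply, fourierCoeff_smoothing, fourierCoeff_toLp,
      fourierCoeff_toLp, hk c hc _ (hG c hc), mul_div_cancel_left₀ _ h0]
  unfold PerSobolev.IsClassOf
  rw [e]
  filter_upwards [ContinuousMap.coeFn_toLp (E := ℂ) (p := 2) AddCircle.haarAddCircle (𝕜 := ℂ) (G0 c)]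
    with t ht x hx
  rw [ht, ← hx, hG0 c hc]

end SobolevSmooth

/-! ### Elliptic integrals and the Jacobi amplitude -/

section Jacobi

open Filter Topology

variable {k : ℝ}

theorem one_sub_sq_mul_sin_sq_pos (hk : k ^ 2 < 1) (θ : ℝ) : 0 < 1 - k ^ 2 * sin θ ^ 2 := by
  nlinarith [sin_sq_le_one θ, sq_nonneg (sin θ), sq_nonneg k]

theorem continuous_ellipticF_integrand (hk : k ^ 2 < 1) :
    Continuous fun θ => 1 / √(1 - k ^ 2 * sin θ ^ 2) :=
  Continuous.div (by fun_prop) (by fun_prop)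
    fun θ => (sqrt_pos.2 (one_sub_sq_mul_sin_sq_pos hk θ)).ne'

theorem hasDerivAt_ellipticF (hk : k ^ 2 < 1) (θ : ℝ) :
    HasDerivAt (ellipticF k) (1 / √(1 - k ^ 2 * sin θ ^ 2)) θ :=
  (continuous_ellipticF_integrand hk).integral_hasStrictDerivAt 0 θ |>.hasDerivAt

theorem ellipticF_zero (k : ℝ) : ellipticF k 0 = 0 := by simp [ellipticF]

theorem strictMono_ellipticF (hk : k ^ 2 < 1) : StrictMono (ellipticF k) := by
  refine strictMono_of_deriv_pos fun θ => ?_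
  rw [(hasDerivAt_ellipticF hk θ).deriv]
  have := one_sub_sq_mul_sin_sq_pos hk θ
  positivity

/-- The integrand is at least `1`; so `F` grows at least like `θ` and is onto. -/
theorem monotone_ellipticF_sub (hk : k ^ 2 < 1) : Monotone fun θ => ellipticF k θ - θ := by
  refine monotone_of_deriv_nonneg
    (fun θ => ((hasDerivAt_ellipticF hk θ).sub (hasDerivAt_id θ)).differentiableAt) fun θ => ?_
  have hd : HasDerivAt (fun θ => ellipticF k θ - θ) _ θ :=
    (hasDerivAt_ellipticF hk θ).sub (hasDerivAt_id θ)
  rw [hd.deriv, sub_nonneg, le_div_iff₀ (sqrt_pos.2 (one_sub_sq_mul_sin_sq_pos hk θ)), one_mul]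
  exact Real.sqrt_le_iff.2 ⟨zero_le_one, by nlinarith [sq_nonneg (k * sin θ)]⟩

theorem surjective_ellipticF (hk : k ^ 2 < 1) : Function.Surjective (ellipticF k) := by
  have hc : Continuous (ellipticF k) :=
    continuous_iff_continuousAt.2 fun θ => (hasDerivAt_ellipticF hk θ).continuousAt
  refine hc.surjective ?_ ?_
  · refine tendsto_atTop_mono' _ ?_ tendsto_id
    filter_upwards [eventually_ge_atTop 0] with θ hθ
    have := monotone_ellipticF_sub hk hθ
    simp only [ellipticF_zero] at this
    simp only [id]
    linarith
  · refine tendsto_atBot_mono' _ ?_ tendsto_id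
    filter_upwards [eventually_le_atBot 0] with θ hθ
    have := monotone_ellipticF_sub hk hθ
    simp only [ellipticF_zero] at this
    simp only [id]
    linarith

theorem ellipticF_jacobiAm (hk : k ^ 2 < 1) (u : ℝ) : ellipticF k (jacobiAm u k) = u :=
  Function.rightInverse_invFun (surjective_ellipticF hk) u

theorem jacobiAm_ellipticF (hk : k ^ 2 < 1) (θ : ℝ) : jacobiAm (ellipticF k θ) k = θ :=
  Function.leftInverse_invFun (strictMono_ellipticF hk).injective θ

theorem isOpen_sq_lt_one : IsOpen {k : ℝ | k ^ 2 < 1} :=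
  isOpen_lt (by fun_prop) continuous_const

/-- Rescaling to `θ ∫₀¹ f(θt) dt` fixes the limits of integration, so that `θ` becomes an ordinary
parameter beside `k`. -/
theorem contDiffAt_ellipticF (hk : k ^ 2 < 1) (θ : ℝ) :
    ContDiffAt ℝ ∞ (fun z : ℝ × ℝ => ellipticF z.1 z.2) (k, θ) := by
  have hU : IsOpen ({k : ℝ | k ^ 2 < 1} ×ˢ (univ : Set ℝ)) := isOpen_sq_lt_one.prod isOpen_univ
  have h1 : ContDiffOn ℝ ∞
      (fun z : (ℝ × ℝ) × ℝ => 1 / √(1 - z.1.1 ^ 2 * sin (z.1.2 * z.2) ^ 2))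
      (({k : ℝ | k ^ 2 < 1} ×ˢ (univ : Set ℝ)) ×ˢ univ) := by
    have hpos : ∀ z ∈ (({k : ℝ | k ^ 2 < 1} ×ˢ (univ : Set ℝ)) ×ˢ (univ : Set ℝ)),
        0 < 1 - z.1.1 ^ 2 * sin (z.1.2 * z.2) ^ 2 :=
      fun z hz => one_sub_sq_mul_sin_sq_pos hz.1.1 _
    have h0 : ContDiff ℝ ∞ fun z : (ℝ × ℝ) × ℝ => 1 - z.1.1 ^ 2 * sin (z.1.2 * z.2) ^ 2 := by
      fun_prop
    exact contDiffOn_const.div (h0.contDiffOn.sqrt fun z hz => (hpos z hz).ne')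
      fun z hz => (sqrt_pos.2 (hpos z hz)).ne'
  have h2 := contDiffOn_parametric_integral hU h1 zero_le_one
  have h3 := contDiff_snd.contDiffOn.mul h2
  refine (h3.contDiffAt (hU.mem_nhds (show (k, θ) ∈ _ from
    ⟨hk, mem_univ _⟩))).congr_of_eventuallyEq ?_
  filter_upwards with z
  have h4 := intervalIntegral.smul_integral_comp_mul_left (a := 0) (b := 1)
    (fun ϑ => 1 / √(1 - z.1 ^ 2 * sin ϑ ^ 2)) z.2
  rw [mul_zero, mul_one] at h4
  exact h4.symm

theorem contDiffAt_jacobiAm (hk : k ^ 2 < 1) (u : ℝ) :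
    ContDiffAt ℝ ∞ (fun z : ℝ × ℝ => jacobiAm z.1 z.2) (u, k) := by
  refine contDiffAt_of_implicit (f := fun w : (ℝ × ℝ) × ℝ => ellipticF w.1.2 w.2 - w.1.1)
    (d := 1 / √(1 - k ^ 2 * sin (jacobiAm u k) ^ 2)) (l := 0) ?_ ?_ ?_ ?_ ?_
  · refine ContDiffAt.sub ?_ (by fun_prop)
    exact (contDiffAt_ellipticF hk (jacobiAm u k)).comp (f := fun w : (ℝ × ℝ) × ℝ => (w.1.2, w.2))
      ((u, k), jacobiAm u k) (by fun_prop)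
  · exact (hasDerivAt_ellipticF hk _).sub_const u
  · have := one_sub_sq_mul_sin_sq_pos hk (jacobiAm u k)
    positivity
  · simp [ellipticF_jacobiAm hk]
  · have : ∀ᶠ w : (ℝ × ℝ) × ℝ in 𝓝 ((u, k), jacobiAm u k), w.1.2 ∈ {k : ℝ | k ^ 2 < 1} :=
      (show Continuous fun w : (ℝ × ℝ) × ℝ => w.1.2 by fun_prop).continuousAt.eventually
        (isOpen_sq_lt_one.mem_nhds hk)
    filter_upwards [this] with w hw h
    rw [← sub_eq_zero.1 h, jacobiAm_ellipticF hw]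

theorem hasDerivAt_jacobiAm (hk : k ^ 2 < 1) (u : ℝ) :
    HasDerivAt (fun v => jacobiAm v k) (√(1 - k ^ 2 * sin (jacobiAm u k) ^ 2)) u := by
  have hpos := one_sub_sq_mul_sin_sq_pos hk (jacobiAm u k)
  have hc : ContinuousAt (fun v => jacobiAm v k) u :=
    (contDiffAt_jacobiAm hk u).continuousAt.comp (f := fun v => (v, k)) (by fun_prop)
  have := HasDerivAt.of_local_left_inverse hc (hasDerivAt_ellipticF hk _) (by positivity)
    (Eventually.of_forall (ellipticF_jacobiAm hk))
  simpa using this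

theorem sin_image_Ioo : sin '' Ioo 0 (π / 2) = Ioo 0 1 := by
  ext t
  constructor
  · rintro ⟨θ, ⟨h0, h1⟩, rfl⟩
    refine ⟨sin_pos_of_pos_of_lt_pi h0 (by linarith [pi_pos]), ?_⟩
    have := sin_lt_sin_of_lt_of_le_pi_div_two (by linarith [pi_pos]) le_rfl h1
    rwa [sin_pi_div_two] at this
  · rintro ⟨h0, h1⟩
    exact ⟨arcsin t, ⟨arcsin_pos.2 h0, arcsin_lt_pi_div_two.2 h1⟩,
      sin_arcsin (by linarith) h1.le⟩

/-- Substitution `t = sin θ` on open intervals. The change of variables needs no integrability, so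
neither the singularity at `t = 1` nor the size of `k` matters. -/
theorem ellipticK_eq_ellipticF (k : ℝ) : ellipticK k = ellipticF k (π / 2) := by
  rw [ellipticK, ellipticF, intervalIntegral.integral_of_le zero_le_one,
    intervalIntegral.integral_of_le (by positivity), integral_Ioc_eq_integral_Ioo,
    integral_Ioc_eq_integral_Ioo, ← sin_image_Ioo,
    integral_image_eq_integral_abs_deriv_smul measurableSet_Ioo
      (fun θ _ => (hasDerivAt_sin θ).hasDerivWithinAt)
      (injOn_sin.mono (Ioo_subset_Icc_self.trans (Icc_subset_Icc_left (by linarith [pi_pos]))))]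
  refine setIntegral_congr_fun measurableSet_Ioo fun θ hθ => ?_
  have hc : 0 < cos θ := cos_pos_of_mem_Ioo ⟨by linarith [hθ.1, pi_pos], hθ.2⟩
  have h1 : 1 - sin θ ^ 2 = cos θ ^ 2 := by rw [← sin_sq_add_cos_sq θ]; ring
  simp only [h1, smul_eq_mul, abs_of_pos hc]
  rw [Real.sqrt_mul' _ (by positivity), Real.sqrt_sq hc.le]
  field_simp

theorem ellipticF_pi (hk : k ^ 2 < 1) : ellipticF k π = 2 * ellipticK k := by
  have hi := fun a b => (continuous_ellipticF_integrand hk).intervalIntegrable (μ := volume) a b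
  have h1 := intervalIntegral.integral_comp_sub_left (a := π / 2) (b := π)
    (fun θ => 1 / √(1 - k ^ 2 * sin θ ^ 2)) π
  simp only [sin_pi_sub, sub_self, sub_half] at h1
  rw [ellipticK_eq_ellipticF, ellipticF, ellipticF,
    ← intervalIntegral.integral_add_adjacent_intervals (hi 0 (π / 2)) (hi (π / 2) π), h1]
  ring

theorem ellipticF_add_pi (hk : k ^ 2 < 1) (θ : ℝ) :
    ellipticF k (θ + π) = ellipticF k θ + 2 * ellipticK k := by
  have hi := fun a b => (continuous_ellipticF_integrand hk).intervalIntegrable (μ := volume) a b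
  have hp : Function.Periodic (fun θ => 1 / √(1 - k ^ 2 * sin θ ^ 2)) π := fun θ => by
    simp [sin_add_pi]
  have h1 := hp.intervalIntegral_add_eq θ 0
  rw [zero_add] at h1
  rw [← ellipticF_pi hk, ellipticF, ellipticF, ellipticF, ← h1]
  exact (intervalIntegral.integral_add_adjacent_intervals (hi _ _) (hi _ _)).symm

theorem jacobiAm_add (hk : k ^ 2 < 1) (u : ℝ) :
    jacobiAm (u + 2 * ellipticK k) k = jacobiAm u k + π := by
  conv_lhs => rw [← ellipticF_jacobiAm hk u, ← ellipticF_add_pi hk]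
  exact jacobiAm_ellipticF hk _

theorem jacobiAm_zero (hk : k ^ 2 < 1) : jacobiAm 0 k = 0 := by
  conv_lhs => rw [← ellipticF_zero k]
  exact jacobiAm_ellipticF hk 0

/-- The amplitude at a positive zero of `sn` is a positive multiple of `π`, and `F(π) = 2K`. This
excludes periods of the profile shorter than `L`. -/
theorem le_of_jacobiSn_eq_zero (hk : k ^ 2 < 1) {u : ℝ} (hu : 0 < u) (h : jacobiSn u k = 0) :
    2 * ellipticK k ≤ u := by
  obtain ⟨n, hn⟩ := sin_eq_zero_iff.1 h
  rw [← ellipticF_jacobiAm hk u] at hu ⊢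
  rw [← ellipticF_pi hk, (strictMono_ellipticF hk).le_iff_le]
  rw [← ellipticF_zero k, (strictMono_ellipticF hk).lt_iff_lt] at hu
  rw [← hn] at hu ⊢
  have : 0 < n := by
    by_contra h'
    have : (n : ℝ) ≤ 0 := by exact_mod_cast not_lt.1 h'
    nlinarith [pi_pos]
  have : (1 : ℝ) ≤ n := by exact_mod_cast this
  nlinarith [pi_pos]

theorem ellipticK_pos (hk : k ^ 2 < 1) : 0 < ellipticK k := by
  rw [ellipticK_eq_ellipticF, ← ellipticF_zero k]
  exact strictMono_ellipticF hk (by positivity)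

end Jacobi

/-! ### The Gauss integral and the arithmetic-geometric mean step -/

section GaussIntegral

open Filter Topology

/-- `∫₀^{π/2} dθ / √(P cos² θ + Q sin² θ)`. -/
noncomputable def gaussIntegral (P Q : ℝ) : ℝ :=
  ∫ θ in (0 : ℝ)..π / 2, 1 / √(P * cos θ ^ 2 + Q * sin θ ^ 2)

theorem gauss_form_pos {P Q : ℝ} (hP : 0 < P) (hQ : 0 < Q) (θ : ℝ) :
    0 < P * cos θ ^ 2 + Q * sin θ ^ 2 := by
  rcases eq_or_ne (cos θ) 0 with h | h
  · have h1 := sin_sq_add_cos_sq θ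
    rw [h] at h1 ⊢
    nlinarith
  · have := sq_pos_of_ne_zero h
    have := sq_nonneg (sin θ)
    positivity

theorem continuous_gauss_integrand {P Q : ℝ} (hP : 0 < P) (hQ : 0 < Q) :
    Continuous fun θ => 1 / √(P * cos θ ^ 2 + Q * sin θ ^ 2) :=
  Continuous.div (by fun_prop) (by fun_prop) fun θ => (sqrt_pos.2 (gauss_form_pos hP hQ θ)).ne'

theorem tan_image_Ioo {b : ℝ} (hb : 0 < b) :
    (fun θ => b * tan θ) '' Ioo 0 (π / 2) = Ioi 0 := by
  ext t
  constructor
  · rintro ⟨θ, ⟨h0, h1⟩, rfl⟩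
    exact mul_pos hb (tan_pos_of_pos_of_lt_pi_div_two h0 h1)
  · intro ht
    refine ⟨arctan (t / b), ⟨arctan_pos.2 (div_pos ht hb), arctan_lt_pi_div_two _⟩, ?_⟩
    simp only [tan_arctan]
    field_simp

/-- Substitution `x = b tan θ`; this algebraic form is the one in which the Gauss transformation is
rational. -/
theorem gaussIntegral_eq_integral_Ioi {a b : ℝ} (ha : 0 < a) (hb : 0 < b) :
    gaussIntegral (a ^ 2) (b ^ 2) =
      ∫ x in Ioi (0 : ℝ), 1 / √((x ^ 2 + a ^ 2) * (x ^ 2 + b ^ 2)) := by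
  have hc : ∀ θ ∈ Ioo 0 (π / 2), 0 < cos θ := fun θ hθ =>
    cos_pos_of_mem_Ioo ⟨by linarith [hθ.1, pi_pos], hθ.2⟩
  rw [← tan_image_Ioo hb, integral_image_eq_integral_abs_deriv_smul measurableSet_Ioo
      (fun θ hθ => ((hasDerivAt_tan (hc θ hθ).ne').const_mul b).hasDerivWithinAt),
    gaussIntegral, intervalIntegral.integral_of_le (by positivity), integral_Ioc_eq_integral_Ioo]
  · refine setIntegral_congr_fun measurableSet_Ioo fun θ hθ => ?_
    have h := hc θ hθ
    have hf := gauss_form_pos (P := a ^ 2) (Q := b ^ 2) (by positivity) (by positivity) θ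
    have h1 : ((b * tan θ) ^ 2 + a ^ 2) * ((b * tan θ) ^ 2 + b ^ 2) =
        (a ^ 2 * cos θ ^ 2 + b ^ 2 * sin θ ^ 2) * (b / cos θ ^ 2) ^ 2 := by
      rw [tan_eq_sin_div_cos]
      field_simp
      rw [sin_sq]
      ring
    simp only [h1, smul_eq_mul]
    rw [Real.sqrt_mul hf.le, Real.sqrt_sq (by positivity), abs_of_pos (by positivity)]
    have := sqrt_pos.2 hf
    field_simp
  · intro x hx y hy hxy
    have h1 : tan x = tan y := mul_left_cancel₀ hb.ne' hxy
    have hpi := pi_pos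
    exact injOn_tan ⟨by linarith [hx.1], hx.2⟩ ⟨by linarith [hy.1], hy.2⟩ h1

theorem image_sub_div_Ioi {m : ℝ} (hm : 0 < m) :
    (fun x : ℝ => (x - m / x) / 2) '' Ioi 0 = univ := by
  refine eq_univ_of_forall fun t => ?_
  have h0 : 0 < t ^ 2 + m := by positivity
  have h1 := Real.sq_sqrt h0.le
  have h2 : |t| < √(t ^ 2 + m) := Real.lt_sqrt_of_sq_lt (by rw [sq_abs]; linarith)
  have h3 : 0 < t + √(t ^ 2 + m) := by linarith [neg_abs_le t]
  refine ⟨t + √(t ^ 2 + m), h3, ?_⟩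
  beta_reduce
  field_simp
  nlinarith

theorem injOn_sub_div {m : ℝ} (hm : 0 < m) : InjOn (fun x : ℝ => (x - m / x) / 2) (Ioi 0) := by
  refine StrictMonoOn.injOn fun x hx y hy hxy => ?_
  have := div_lt_div_of_pos_left hm hx hxy
  linarith

/-- The Gauss transformation: the integral is invariant under the arithmetic-geometric mean
step. -/
theorem gaussIntegral_agm {a b : ℝ} (ha : 0 < a) (hb : 0 < b) :
    gaussIntegral (a ^ 2) (b ^ 2) = gaussIntegral (((a + b) / 2) ^ 2) (a * b) := by
  have hab := mul_pos ha hb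
  have h1 : gaussIntegral (((a + b) / 2) ^ 2) (a * b) =
      ∫ x in Ioi (0 : ℝ), 1 / √((x ^ 2 + ((a + b) / 2) ^ 2) * (x ^ 2 + a * b)) := by
    have := gaussIntegral_eq_integral_Ioi (a := (a + b) / 2) (by positivity) (sqrt_pos.2 hab)
    rwa [Real.sq_sqrt hab.le] at this
  -- The right-hand integrand is even, so twice its half-line integral is an integral over `ℝ`, on
  -- which `t = (x - ab/x)/2` is substituted with `x > 0`.
  have h2 := integral_comp_abs
    (f := fun x => 1 / √((x ^ 2 + ((a + b) / 2) ^ 2) * (x ^ 2 + a * b)))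
  simp only [sq_abs] at h2
  rw [← h1, ← setIntegral_univ, ← image_sub_div_Ioi hab,
    integral_image_eq_integral_abs_deriv_smul measurableSet_Ioi
      (f' := fun x => (1 + a * b / x ^ 2) / 2)
      (fun x hx => ?_) (injOn_sub_div hab)] at h2
  · have h3 : ∀ x ∈ Ioi (0 : ℝ), |(1 + a * b / x ^ 2) / 2| •
        (1 / √((((x - a * b / x) / 2) ^ 2 + ((a + b) / 2) ^ 2) *
          (((x - a * b / x) / 2) ^ 2 + a * b))) =
        2 * (1 / √((x ^ 2 + a ^ 2) * (x ^ 2 + b ^ 2))) := by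
      intro x hx
      have hx : 0 < x := hx
      have e1 : (((x - a * b / x) / 2) ^ 2 + ((a + b) / 2) ^ 2) *
          (((x - a * b / x) / 2) ^ 2 + a * b) =
          ((x ^ 2 + a ^ 2) * (x ^ 2 + b ^ 2)) * ((1 + a * b / x ^ 2) / 4) ^ 2 := by
        field_simp
        ring
      have e2 : 0 < (x ^ 2 + a ^ 2) * (x ^ 2 + b ^ 2) := by positivity
      rw [e1, Real.sqrt_mul e2.le, Real.sqrt_sq (by positivity), abs_of_pos (by positivity),
        smul_eq_mul]
      have := sqrt_pos.2 e2
      field_simp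
      ring
    rw [setIntegral_congr_fun measurableSet_Ioi h3, integral_const_mul,
      ← gaussIntegral_eq_integral_Ioi ha hb] at h2
    linarith
  · have hx0 : x ≠ 0 := (show 0 < x from hx).ne'
    have := (((hasDerivAt_id x).sub ((hasDerivAt_inv hx0).const_mul (a * b))).div_const 2)
    refine (this.congr_deriv ?_).hasDerivWithinAt
    field_simp
    ring

theorem isOpen_pos_prod : IsOpen (Ioi (0 : ℝ) ×ˢ Ioi (0 : ℝ)) := isOpen_Ioi.prod isOpen_Ioi

theorem contDiffOn_gaussIntegral :
    ContDiffOn ℝ ∞ (fun z : ℝ × ℝ => gaussIntegral z.1 z.2) (Ioi 0 ×ˢ Ioi 0) := by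
  refine contDiffOn_parametric_integral isOpen_pos_prod
    (H := fun z : (ℝ × ℝ) × ℝ => 1 / √(z.1.1 * cos z.2 ^ 2 + z.1.2 * sin z.2 ^ 2)) ?_ (by positivity)
  have hpos : ∀ z ∈ ((Ioi (0 : ℝ) ×ˢ Ioi (0 : ℝ)) ×ˢ (univ : Set ℝ)),
      0 < z.1.1 * cos z.2 ^ 2 + z.1.2 * sin z.2 ^ 2 :=
    fun z hz => gauss_form_pos hz.1.1 hz.1.2 _
  have h0 : ContDiff ℝ ∞ fun z : (ℝ × ℝ) × ℝ => z.1.1 * cos z.2 ^ 2 + z.1.2 * sin z.2 ^ 2 := by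
    fun_prop
  exact contDiffOn_const.div (h0.contDiffOn.sqrt fun z hz => (hpos z hz).ne')
    fun z hz => (sqrt_pos.2 (hpos z hz)).ne'

theorem contDiffAt_gaussIntegral {P Q : ℝ} (hP : 0 < P) (hQ : 0 < Q) :
    ContDiffAt ℝ ∞ (fun z : ℝ × ℝ => gaussIntegral z.1 z.2) (P, Q) :=
  contDiffOn_gaussIntegral.contDiffAt (isOpen_pos_prod.mem_nhds ⟨hP, hQ⟩)

/-- Along a line in a negative direction the integral has a positive derivative. -/
theorem hasDerivAt_gaussIntegral_line {P Q v w : ℝ} (hP : 0 < P) (hQ : 0 < Q) (hv : v < 0)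
    (hw : w < 0) : ∃ d > 0, HasDerivAt (fun z => gaussIntegral (P + z * v) (Q + z * w)) d 0 := by
  set U : Set ℝ := {z | 0 < P + z * v ∧ 0 < Q + z * w} with hUdef
  have hU : IsOpen U :=
    (isOpen_lt (f := fun _ : ℝ => (0 : ℝ)) (g := fun z => P + z * v) (by fun_prop)
      (by fun_prop)).inter
    (isOpen_lt (f := fun _ : ℝ => (0 : ℝ)) (g := fun z => Q + z * w) (by fun_prop) (by fun_prop))
  set R : ℝ × ℝ → ℝ := fun z => (P + z.1 * v) * cos z.2 ^ 2 + (Q + z.1 * w) * sin z.2 ^ 2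
    with hR
  have hRpos : ∀ z ∈ U ×ˢ (univ : Set ℝ), 0 < R z := fun z hz => gauss_form_pos hz.1.1 hz.1.2 _
  have hRc : Continuous R := by fun_prop
  have h0U : (0 : ℝ) ∈ U := by simp [hUdef, hP, hQ]
  set H' : ℝ × ℝ → ℝ := fun z => (-(v * cos z.2 ^ 2 + w * sin z.2 ^ 2)) / (2 * √(R z) ^ 3)
    with hH'
  have hcH' : ContinuousOn H' (U ×ˢ univ) :=
    ContinuousOn.div (by fun_prop) (by fun_prop) fun z hz => by
      have := hRpos z hz
      positivity
  have key := hasDerivAt_parametric_integral hU (H := fun z => 1 / √(R z)) (H' := H')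
    (ContinuousOn.div (by fun_prop) (by fun_prop) fun z hz => (sqrt_pos.2 (hRpos z hz)).ne')
    hcH' (fun y hy t => by
      have hp := hRpos (y, t) ⟨hy, mem_univ _⟩
      have hd : HasDerivAt (fun z => R (z, t)) (v * cos t ^ 2 + w * sin t ^ 2) y := by
        have h1 := (((hasDerivAt_id y).mul_const v).const_add P).mul_const (cos t ^ 2)
        have h2 := (((hasDerivAt_id y).mul_const w).const_add Q).mul_const (sin t ^ 2)
        exact (h1.add h2).congr_deriv (by ring)
      have h3 := (hd.sqrt hp.ne').inv (sqrt_pos.2 hp).ne'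
      simp only [one_div]
      refine h3.congr_deriv ?_
      simp only [hH']
      have := sqrt_pos.2 hp
      field_simp) (a := 0) (b := π / 2) (by positivity) h0U
  refine ⟨_, ?_, key⟩
  have hpos : ∀ t, 0 < H' (0, t) := fun t => by
    have h1 := hRpos (0, t) ⟨h0U, mem_univ _⟩
    have h2 := gauss_form_pos (neg_pos.2 hv) (neg_pos.2 hw) t
    refine div_pos ?_ (by positivity)
    simp only
    linarith
  have hc : Continuous fun t => H' (0, t) :=
    hcH'.comp_continuous (f := fun t => ((0 : ℝ), t)) (by fun_prop) fun t => ⟨h0U, mem_univ _⟩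
  exact intervalIntegral.intervalIntegral_pos_of_pos (hc.intervalIntegrable _ _) hpos (by positivity)

/-- By the chain rule only the position and velocity of the curve `(P, Q)` matter, so it may be
replaced by its tangent line. -/
theorem hasDerivAt_gaussIntegral_comp {P Q : ℝ → ℝ} {P' Q' x : ℝ} (hP : 0 < P x) (hQ : 0 < Q x)
    (hP' : HasDerivAt P P' x) (hQ' : HasDerivAt Q Q' x) (h1 : P' < 0) (h2 : Q' < 0) :
    ∃ d > 0, HasDerivAt (fun y => gaussIntegral (P y) (Q y)) d x := by
  have hN := ((contDiffAt_gaussIntegral hP hQ).differentiableAt (by simp)).hasFDerivAt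
  obtain ⟨d, hd, hl⟩ := hasDerivAt_gaussIntegral_line hP hQ h1 h2
  refine ⟨d, hd, ?_⟩
  have e1 := hN.comp_hasDerivAt x (hP'.prodMk hQ')
  have hN0 : HasFDerivAt (fun z : ℝ × ℝ => gaussIntegral z.1 z.2)
      (fderiv ℝ (fun z : ℝ × ℝ => gaussIntegral z.1 z.2) (P x, Q x))
      (P x + 0 * P', Q x + 0 * Q') := by simpa using hN
  have e2 := hN0.comp_hasDerivAt (0 : ℝ)
    ((((hasDerivAt_id (0 : ℝ)).mul_const P').const_add (P x)).prodMk
      (((hasDerivAt_id (0 : ℝ)).mul_const Q').const_add (Q x)))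
  rw [one_mul, one_mul] at e2
  rw [hl.unique e2]
  exact e1

theorem gaussIntegral_self (P : ℝ) : gaussIntegral P P = π / 2 / √P := by
  have : ∀ θ, P * cos θ ^ 2 + P * sin θ ^ 2 = P := fun θ => by
    rw [← mul_add, cos_sq_add_sin_sq, mul_one]
  simp only [gaussIntegral, this, intervalIntegral.integral_const, smul_eq_mul]
  ring

/-- The logarithmic lower bound. -/
theorem le_gaussIntegral {P Q : ℝ} (hP : 0 < P) (hQ : 0 < Q) :
    (√P)⁻¹ * log ((√P * (π / 2) + √Q) / √Q) ≤ gaussIntegral P Q := by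
  have hp := sqrt_pos.2 hP
  have hq := sqrt_pos.2 hQ
  have h1 : ∫ θ in (0 : ℝ)..π / 2, 1 / (√P * (π / 2 - θ) + √Q) =
      (√P)⁻¹ * log ((√P * (π / 2) + √Q) / √Q) := by
    have e1 := intervalIntegral.integral_comp_sub_left (a := 0) (b := π / 2)
      (fun θ => 1 / (√P * θ + √Q)) (π / 2)
    have e2 := intervalIntegral.integral_comp_mul_add (a := 0) (b := π / 2)
      (fun θ => 1 / θ) hp.ne' (√Q)
    rw [e1, sub_self, sub_zero, e2, integral_one_div_of_pos (by simpa using hq) (by positivity)]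
    simp
  rw [← h1, gaussIntegral]
  refine intervalIntegral.integral_mono_on (by positivity) ?_
    ((continuous_gauss_integrand hP hQ).intervalIntegrable _ _) fun θ hθ => ?_
  · refine ContinuousOn.intervalIntegrable (ContinuousOn.div (by fun_prop) (by fun_prop) ?_)
    intro θ hθ
    rw [uIcc_of_le (by positivity)] at hθ
    have : 0 ≤ √P * (π / 2 - θ) := mul_nonneg hp.le (by linarith [hθ.2])
    positivity
  · have h0 : 0 ≤ π / 2 - θ := by linarith [hθ.2]
    -- The bounds `cos θ ≤ π/2 - θ` and `sin θ ≤ 1` give `√(P cos² θ + Q sin² θ) ≤ √P (π/2 - θ) +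
    -- √Q`, whose reciprocal integrates to a logarithm.
    refine one_div_le_one_div_of_le (sqrt_pos.2 (gauss_form_pos hP hQ θ)) ?_
    refine Real.sqrt_le_iff.2 ⟨by positivity, ?_⟩
    have hc : cos θ ^ 2 ≤ (π / 2 - θ) ^ 2 := by
      rw [← sin_pi_div_two_sub]
      exact pow_le_pow_left₀ (sin_nonneg_of_nonneg_of_le_pi h0 (by linarith [hθ.1, pi_pos]))
        (sin_le h0) 2
    have hs : sin θ ^ 2 ≤ 1 := sin_sq_le_one θ
    have e1 : P * cos θ ^ 2 ≤ (√P * (π / 2 - θ)) ^ 2 := by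
      rw [mul_pow, Real.sq_sqrt hP.le]
      gcongr
    have e2 : Q * sin θ ^ 2 ≤ √Q ^ 2 := by
      rw [Real.sq_sqrt hQ.le]
      nlinarith
    nlinarith [mul_nonneg (mul_nonneg hp.le h0) hq.le]

/-- Write `1 - k² sin² θ = cos² θ + (1 - k²) sin² θ` and absorb the prefactor; this is the passage
from `K` to the Gauss integral. -/
theorem ellipticK_div {k A : ℝ} (hA : 0 < A) (hk : k ^ 2 < 1) :
    ellipticK k / √A = gaussIntegral A (A * (1 - k ^ 2)) := by
  rw [ellipticK_eq_ellipticF, ellipticF, gaussIntegral, div_eq_mul_inv,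
    ← intervalIntegral.integral_mul_const]
  refine intervalIntegral.integral_congr fun θ _ => ?_
  have h : A * cos θ ^ 2 + A * (1 - k ^ 2) * sin θ ^ 2 = (1 - k ^ 2 * sin θ ^ 2) * A := by
    rw [cos_sq']
    ring
  simp only [h]
  rw [Real.sqrt_mul (one_sub_sq_mul_sin_sq_pos hk θ).le]
  have := sqrt_pos.2 hA
  have := sqrt_pos.2 (one_sub_sq_mul_sin_sq_pos hk θ)
  field_simp

end GaussIntegral

/-! ### The roots of the cubic and monotonicity of the period -/

section Roots

open Filter Topology

variable {α c : ℝ}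

/-- The condition that `0 < α₃ ≤ α₄`. -/
structure WeaklyAdmissible (α c : ℝ) : Prop where
  pos : 0 < α
  lower : rOf c ≤ α ^ 2 + α
  upper : α ^ 2 + 3 / 2 * α < 3 * rOf c

theorem mem_admissible_iff (hr : 0 < rOf c) :
    α ∈ admissible c ↔ 0 < α ∧ rOf c < α ^ 2 + α ∧ α ^ 2 + 3 / 2 * α < 3 * rOf c := by
  have h1 : 1 < √(1 + 4 * rOf c) := Real.lt_sqrt_of_sq_lt (by linarith)
  have h2 : 3 < √(9 + 48 * rOf c) := Real.lt_sqrt_of_sq_lt (by linarith)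
  have e1 := Real.sq_sqrt (show 0 ≤ 1 + 4 * rOf c by positivity)
  have e2 := Real.sq_sqrt (show 0 ≤ 9 + 48 * rOf c by positivity)
  simp only [admissible, mem_Ioo]
  constructor
  · rintro ⟨h3, h4⟩
    have h0 : 0 < α := by linarith
    refine ⟨h0, ?_, ?_⟩
    · nlinarith
    · nlinarith
  · rintro ⟨h0, h3, h4⟩
    constructor
    · have : √(1 + 4 * rOf c) < 2 * α + 1 := (Real.sqrt_lt' (by linarith)).2 (by nlinarith)
      linarith
    · have : 4 * α + 3 < √(9 + 48 * rOf c) := Real.lt_sqrt_of_sq_lt (by nlinarith)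
      linarith

theorem WeaklyAdmissible.of_mem (hr : 0 < rOf c) (h : α ∈ admissible c) :
    WeaklyAdmissible α c := by
  obtain ⟨h1, h2, h3⟩ := (mem_admissible_iff hr).1 h
  exact ⟨h1, h2.le, h3⟩

namespace WeaklyAdmissible

variable (h : WeaklyAdmissible α c)
include h

theorem rOf_pos : 0 < rOf c := by nlinarith [h.pos, h.upper]

theorem betaOf_pos : 0 < betaOf α c := by
  unfold betaOf
  nlinarith [h.pos, h.upper, h.rOf_pos]

theorem sq_sqrt_three_mul : (√3 * √(betaOf α c)) ^ 2 = 3 * betaOf α c := by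
  rw [mul_pow, Real.sq_sqrt (by norm_num), Real.sq_sqrt h.betaOf_pos.le]

/-- Vieta's relation: `α₁, α₃, α₄` have sum `-3/2` and second symmetric function `-3r`. -/
theorem alpha1_mul_alpha3 : alpha1 α c * alpha3 α c = α ^ 2 + 3 / 2 * α - 3 * rOf c := by
  have := h.sq_sqrt_three_mul
  unfold alpha1 alpha3
  unfold betaOf at *
  linear_combination -this / 16

theorem lt_sqrt : 2 * α + 3 < √3 * √(betaOf α c) := by
  refine lt_of_pow_lt_pow_left₀ 2 (by positivity) ?_
  rw [h.sq_sqrt_three_mul, betaOf]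
  nlinarith [h.upper]

theorem sqrt_le : √3 * √(betaOf α c) ≤ 6 * α + 3 := by
  refine le_of_sq_le_sq ?_ (by linarith [h.pos])
  rw [h.sq_sqrt_three_mul, betaOf]
  nlinarith [h.lower]

theorem alpha1_neg : alpha1 α c < 0 := by
  have := h.lt_sqrt
  have := h.pos
  unfold alpha1
  linarith

theorem alpha3_pos : 0 < alpha3 α c := by
  have := h.lt_sqrt
  unfold alpha3
  linarith

theorem alpha3_le : alpha3 α c ≤ α := by
  have := h.sqrt_le
  unfold alpha3
  linarith

/-- Numerator and denominator of the definition are four times these products, and in the roots the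
signs of `k²` and `1 - k²` are visible. -/
theorem modulusSq_eq :
    modulusSq α c = -alpha1 α c * (α - alpha3 α c) / (α * (alpha3 α c - alpha1 α c)) := by
  have h1 := sqrt_pos.2 h.betaOf_pos
  have h2 : (0 : ℝ) < √3 := by positivity
  have h3 := h.pos
  have h4 := h.alpha1_mul_alpha3
  have h5 : alpha3 α c - alpha1 α c = √3 * √(betaOf α c) / 2 := by unfold alpha1 alpha3; ring
  have h6 : -alpha1 α c * (α - alpha3 α c) = (6 * α ^ 2 + 9 * α - 12 * rOf c +
      α * √3 * √(betaOf α c)) / 4 := by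
    have : alpha1 α c * α = (-2 * α - 3 - √3 * √(betaOf α c)) / 4 * α := rfl
    linear_combination h4 - this
  rw [h6, h5, modulusSq]
  field_simp
  norm_num

theorem sub_pos : 0 < α * (alpha3 α c - alpha1 α c) :=
  mul_pos h.pos (by linarith [h.alpha1_neg, h.alpha3_pos])

theorem sub_pos' : 0 < alpha3 α c * (α - alpha1 α c) :=
  mul_pos h.alpha3_pos (by linarith [h.alpha1_neg, h.pos])

theorem one_sub_modulusSq : α * (alpha3 α c - alpha1 α c) * (1 - modulusSq α c) =
    alpha3 α c * (α - alpha1 α c) := by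
  rw [h.modulusSq_eq, mul_sub, mul_one, mul_div_cancel₀ _ h.sub_pos.ne']
  ring

theorem modulusSq_nonneg : 0 ≤ modulusSq α c := by
  rw [h.modulusSq_eq]
  exact div_nonneg (mul_nonneg (by linarith [h.alpha1_neg]) (by linarith [h.alpha3_le])) h.sub_pos.le

theorem modulusSq_lt_one : modulusSq α c < 1 := by
  have h1 := h.one_sub_modulusSq
  have h2 := h.sub_pos
  have h3 := h.sub_pos'
  rw [← h1] at h3
  linarith [(mul_pos_iff_of_pos_left h2).1 h3]

theorem modulus_sq : modulus α c ^ 2 = modulusSq α c := Real.sq_sqrt h.modulusSq_nonneg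

theorem modulus_sq_lt_one : modulus α c ^ 2 < 1 := h.modulus_sq.trans_lt h.modulusSq_lt_one

/-- The factor `√3/2` occurs twice, in `P = α₄√β · √3/2` and `3s = 2√3 s · √3/2`, and cancels;
`K/√P` is then a Gauss integral. -/
theorem periodMap_eq : periodMap α c = 2 * √(3 * sOf c) *
    gaussIntegral (α * (alpha3 α c - alpha1 α c)) (alpha3 α c * (α - alpha1 α c)) := by
  rw [← h.one_sub_modulusSq, ← h.modulus_sq, ← ellipticK_div h.sub_pos h.modulus_sq_lt_one,
    periodMap]
  have h1 := sqrt_pos.2 h.betaOf_pos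
  have h2 : (0 : ℝ) < √3 := by positivity
  have h3 := h.pos
  have h5 : alpha3 α c - alpha1 α c = √3 * √(betaOf α c) / 2 := by unfold alpha1 alpha3; ring
  have h6 : α * (alpha3 α c - alpha1 α c) = (α * √(betaOf α c)) * (√3 / 2) := by rw [h5]; ring
  have h7 : 3 * sOf c = 2 * √3 * sOf c * (√3 / 2) := by
    linear_combination -(sOf c) * Real.sq_sqrt (show (0 : ℝ) ≤ 3 by norm_num)
  have h8 : 0 < √3 / 2 := by positivity
  have h9 : 0 < √(α * √(betaOf α c)) := by positivity
  rw [h6, h7, Real.sqrt_mul' (2 * √3 * sOf c) h8.le, Real.sqrt_mul' (α * √(betaOf α c)) h8.le]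
  have key : ∀ X Y Z K : ℝ, 0 < Y → 0 < Z → 2 * X * K / Y = 2 * (X * Z) * (K / (Y * Z)) := by
    intro X Y Z K hY hZ
    field_simp
  exact key _ _ _ _ h9 (sqrt_pos.2 h8)

end WeaklyAdmissible

/-- The polynomial `(α₄ (α₃ - α₁)) (α₃ (α₄ - α₁))` as a function of `p = α₃ + α₄`. -/
noncomputable def agmProd (r p : ℝ) : ℝ :=
  (p ^ 2 + 3 / 2 * p - 3 * r) * (2 * (p ^ 2 + 3 / 2 * p - 3 * r) + 3 * r + (p + 3 / 2) ^ 2)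

namespace WeaklyAdmissible

variable (h : WeaklyAdmissible α c)
include h

theorem alpha3_mul : alpha3 α c * α =
    (alpha3 α c + α) ^ 2 + 3 / 2 * (alpha3 α c + α) - 3 * rOf c := by
  have h1 : alpha1 α c = -(3 / 2) - (alpha3 α c + α) := by unfold alpha1 alpha3; ring
  have h2 := h.alpha1_mul_alpha3
  rw [h1] at h2
  linear_combination h2

theorem agmProd_eq : α * (alpha3 α c - alpha1 α c) * (alpha3 α c * (α - alpha1 α c)) =
    agmProd (rOf c) (alpha3 α c + α) := by
  have h1 : alpha1 α c = -(3 / 2) - (alpha3 α c + α) := by unfold alpha1 alpha3; ring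
  have h2 := h.alpha3_mul
  unfold agmProd
  rw [← h2, h1]
  linear_combination (-alpha3 α c * α) * h2

theorem agmProd_pos : 0 < agmProd (rOf c) (alpha3 α c + α) := by
  rw [← h.agmProd_eq]
  exact mul_pos h.sub_pos h.sub_pos'

/-- After the mean step only `P + Q` and `PQ` occur. With `q = α₃α₄ = p² + 3p/2 - 3r` Vieta gives `P
+ Q = 3q + 3r`, so both arguments depend on `p = α₃ + α₄` alone. -/
theorem periodMap_eq_agm : periodMap α c = 2 * √(3 * sOf c) *
    gaussIntegral
      ((3 * ((alpha3 α c + α) ^ 2 + 3 / 2 * (alpha3 α c + α) - 3 * rOf c) + 3 * rOf c +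
        2 * √(agmProd (rOf c) (alpha3 α c + α))) / 4)
      (√(agmProd (rOf c) (alpha3 α c + α))) := by
  have hA := sqrt_pos.2 h.sub_pos
  have hB := sqrt_pos.2 h.sub_pos'
  have h1 : alpha1 α c = -(3 / 2) - (alpha3 α c + α) := by unfold alpha1 alpha3; ring
  have key := gaussIntegral_agm hA hB
  rw [Real.sq_sqrt h.sub_pos.le, Real.sq_sqrt h.sub_pos'.le, div_pow, add_sq,
    Real.sq_sqrt h.sub_pos.le, Real.sq_sqrt h.sub_pos'.le, mul_assoc 2 (√_),
    ← Real.sqrt_mul h.sub_pos.le, h.agmProd_eq] at key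
  rw [h.periodMap_eq, key]
  congr 2
  have h2 := h.alpha3_mul
  rw [h1]
  linear_combination (1 / 2) * h2

/-- The sign reduces to `√3√β < 6α₄ + 3`, that is `α₃ < α₄`. At equality the derivative vanishes,
whence the strict hypothesis. -/
theorem hasDerivAt_alpha3_add (hr : rOf c < α ^ 2 + α) :
    ∃ d < 0, HasDerivAt (fun a => alpha3 a c + a) d α := by
  have hb := h.betaOf_pos
  have hsb := sqrt_pos.2 hb
  have h3 : (0 : ℝ) < √3 := by positivity
  have hlt : √3 * √(betaOf α c) < 6 * α + 3 := by
    refine lt_of_pow_lt_pow_left₀ 2 (by linarith [h.pos]) ?_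
    rw [h.sq_sqrt_three_mul, betaOf]
    nlinarith
  have hd : HasDerivAt (fun a => betaOf a c) (-8 * α - 4) α := by
    unfold betaOf
    have h1 := ((((hasDerivAt_id α).pow 2).const_mul (-4)).sub
      ((hasDerivAt_id α).const_mul 4)).add_const (3 + 16 * rOf c)
    refine (h1.congr_deriv (by simp; ring)).congr_of_eventuallyEq ?_
    filter_upwards with a
    simp
    ring
  have hd2 := ((hd.sqrt hb.ne').const_mul √3)
  have hd3 := ((((hasDerivAt_id α).const_mul (-2)).sub_const 3).add hd2).div_const 4 |>.add
    (hasDerivAt_id α)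
  refine ⟨_, ?_, hd3⟩
  have e : √3 * ((-8 * α - 4) / (2 * √(betaOf α c))) =
      -(2 * (6 * α + 3)) / (√3 * √(betaOf α c)) := by
    have := Real.sq_sqrt (show (0 : ℝ) ≤ 3 by norm_num)
    field_simp
    rw [this]
    ring
  rw [e]
  have : -(2 * (6 * α + 3)) / (√3 * √(betaOf α c)) < -2 := by
    rw [div_lt_iff₀ (by positivity)]
    linarith
  linarith

end WeaklyAdmissible

theorem isOpen_admissible (c : ℝ) : IsOpen (admissible c) := isOpen_Ioo

theorem sOf_pos_of_rOf_pos (hr : 0 < rOf c) : 0 < sOf c := by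
  unfold rOf at hr
  unfold sOf
  linarith

/-- The period map is strictly increasing in `α₄`. -/
theorem hasDerivAt_periodMap (hr : 0 < rOf c) (hα : α ∈ admissible c) :
    ∃ d > 0, HasDerivAt (fun a => periodMap a c) d α := by
  have h := WeaklyAdmissible.of_mem hr hα
  obtain ⟨p', hp', hp⟩ := h.hasDerivAt_alpha3_add ((mem_admissible_iff hr).1 hα).2.1
  have hW := h.agmProd_pos
  have hq := h.alpha3_mul
  have hq0 := mul_pos h.alpha3_pos h.pos
  rw [hq] at hq0
  have hp0 : 0 < alpha3 α c + α := by linarith [h.alpha3_pos, h.pos]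
  set p : ℝ → ℝ := fun a => alpha3 a c + a with hpdef
  -- `q = α₃α₄` and `agmProd` increase with `p`, hence decrease in `α₄`, and with them both
  -- arguments of the Gauss integral.
  have hdq : HasDerivAt (fun a => p a ^ 2 + 3 / 2 * p a - 3 * rOf c)
      ((2 * p α + 3 / 2) * p') α :=
    (((hp.pow 2).add (hp.const_mul (3 / 2))).sub_const (3 * rOf c)).congr_deriv (by
      simp; ring)
  have hdq0 : (2 * p α + 3 / 2) * p' < 0 := mul_neg_of_pos_of_neg (by positivity) hp'
  have hdW : HasDerivAt (fun a => agmProd (rOf c) (p a))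
      ((2 * p α + 3 / 2) * p' * (2 * (p α ^ 2 + 3 / 2 * p α - 3 * rOf c) + 3 * rOf c +
        (p α + 3 / 2) ^ 2) + (p α ^ 2 + 3 / 2 * p α - 3 * rOf c) *
        (2 * ((2 * p α + 3 / 2) * p') + 2 * (p α + 3 / 2) * p')) α := by
    refine (hdq.mul (((hdq.const_mul 2).add_const (3 * rOf c)).add
      ((hp.add_const (3 / 2)).pow 2))).congr_deriv (by simp)
  have hdW0 : (2 * p α + 3 / 2) * p' * (2 * (p α ^ 2 + 3 / 2 * p α - 3 * rOf c) + 3 * rOf c +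
        (p α + 3 / 2) ^ 2) + (p α ^ 2 + 3 / 2 * p α - 3 * rOf c) *
        (2 * ((2 * p α + 3 / 2) * p') + 2 * (p α + 3 / 2) * p') < 0 := by
    have h1 : 2 * (p α + 3 / 2) * p' < 0 := mul_neg_of_pos_of_neg (by positivity) hp'
    refine add_neg (mul_neg_of_neg_of_pos hdq0 (by positivity)) (mul_neg_of_pos_of_neg hq0 ?_)
    linarith
  have hdQ := hdW.sqrt hW.ne'
  have hQ := sqrt_pos.2 hW
  have hdQ0 := div_neg_of_neg_of_pos hdW0 (show 0 < 2 * √(agmProd (rOf c) (p α)) by positivity)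
  have hdP := (((hdq.const_mul 3).add_const (3 * rOf c)).add (hdQ.const_mul 2)).div_const 4
  obtain ⟨d, hd, hN⟩ := hasDerivAt_gaussIntegral_comp (x := α)
    (P := fun a => (3 * (p a ^ 2 + 3 / 2 * p a - 3 * rOf c) + 3 * rOf c +
      2 * √(agmProd (rOf c) (p a))) / 4)
    (Q := fun a => √(agmProd (rOf c) (p a))) (by positivity) hQ hdP hdQ (by linarith) hdQ0
  have hs := sOf_pos_of_rOf_pos hr
  refine ⟨2 * √(3 * sOf c) * d, by positivity, (hN.const_mul _).congr_of_eventuallyEq ?_⟩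
  filter_upwards [(isOpen_admissible c).mem_nhds hα] with a ha
  exact (WeaklyAdmissible.of_mem hr ha).periodMap_eq_agm

end Roots

/-! ### Range of the period map and the solution branch -/

section PeriodMap

open Filter Topology

variable {α c L : ℝ}

theorem strictMonoOn_periodMap (hr : 0 < rOf c) :
    StrictMonoOn (fun a => periodMap a c) (admissible c) := by
  refine strictMonoOn_of_deriv_pos (D := admissible c) (convex_Ioo _ _)
    (fun a ha => ?_) fun a ha => ?_
  · obtain ⟨d, -, hd⟩ := hasDerivAt_periodMap hr ha
    exact hd.continuousAt.continuousWithinAt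
  · rw [(isOpen_admissible c).interior_eq] at ha
    obtain ⟨d, hd0, hd⟩ := hasDerivAt_periodMap hr ha
    rwa [hd.deriv]

theorem contDiffAt_betaOf (c α : ℝ) :
    ContDiffAt ℝ ∞ (fun z : ℝ × ℝ => betaOf z.2 z.1) (c, α) := by
  unfold betaOf rOf
  fun_prop

theorem contDiffAt_alpha1 (hb : 0 < betaOf α c) :
    ContDiffAt ℝ ∞ (fun z : ℝ × ℝ => alpha1 z.2 z.1) (c, α) := by
  have h := (contDiffAt_betaOf c α).sqrt hb.ne'
  unfold alpha1
  fun_prop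

theorem contDiffAt_alpha3 (hb : 0 < betaOf α c) :
    ContDiffAt ℝ ∞ (fun z : ℝ × ℝ => alpha3 z.2 z.1) (c, α) := by
  have h := (contDiffAt_betaOf c α).sqrt hb.ne'
  unfold alpha3
  fun_prop

/-- This form stays smooth across the equilibrium `α₃ = α₄`, where `k = √(k²)` has a singular square
root. -/
theorem contDiffAt_gaussPeriod (h : WeaklyAdmissible α c) :
    ContDiffAt ℝ ∞ (fun z : ℝ × ℝ => 2 * √(3 * sOf z.1) *
      gaussIntegral (z.2 * (alpha3 z.2 z.1 - alpha1 z.2 z.1))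
        (alpha3 z.2 z.1 * (z.2 - alpha1 z.2 z.1))) (c, α) := by
  have h1 := contDiffAt_alpha1 h.betaOf_pos
  have h3 := contDiffAt_alpha3 h.betaOf_pos
  have hs : ContDiffAt ℝ ∞ (fun z : ℝ × ℝ => √(3 * sOf z.1)) (c, α) := by
    have hs0 := sOf_pos_of_rOf_pos h.rOf_pos
    refine ContDiffAt.sqrt ?_ (by positivity)
    unfold sOf
    fun_prop
  have hN := (contDiffAt_gaussIntegral h.sub_pos h.sub_pos').comp
    (f := fun z : ℝ × ℝ => (z.2 * (alpha3 z.2 z.1 - alpha1 z.2 z.1),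
      alpha3 z.2 z.1 * (z.2 - alpha1 z.2 z.1))) (c, α) (by fun_prop)
  exact (contDiffAt_const.mul hs).mul hN

theorem eventually_admissible (hr : 0 < rOf c) (hα : α ∈ admissible c) :
    ∀ᶠ z : ℝ × ℝ in 𝓝 (c, α), 0 < rOf z.1 ∧ z.2 ∈ admissible z.1 := by
  obtain ⟨h0, h1, h2⟩ := (mem_admissible_iff hr).1 hα
  have hcr : Continuous fun z : ℝ × ℝ => rOf z.1 := by unfold rOf; fun_prop
  filter_upwards [hcr.continuousAt.eventually_const_lt hr,
    (continuousAt_snd (p := (c, α))).eventually_const_lt h0,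
    (hcr.continuousAt (x := (c, α))).eventually_lt
      (show Continuous fun z : ℝ × ℝ => z.2 ^ 2 + z.2 by fun_prop).continuousAt h1,
    (show Continuous fun z : ℝ × ℝ => z.2 ^ 2 + 3 / 2 * z.2 by fun_prop).continuousAt.eventually_lt
      (g := fun z : ℝ × ℝ => 3 * rOf z.1) (hcr.const_mul 3).continuousAt h2] with z e1 e2 e3 e4
  exact ⟨e1, (mem_admissible_iff e1).2 ⟨e2, e3, e4⟩⟩

theorem contDiffAt_periodMap (hr : 0 < rOf c) (hα : α ∈ admissible c) :
    ContDiffAt ℝ ∞ (fun z : ℝ × ℝ => periodMap z.2 z.1) (c, α) := by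
  refine (contDiffAt_gaussPeriod (.of_mem hr hα)).congr_of_eventuallyEq ?_
  filter_upwards [eventually_admissible hr hα] with z hz
  exact (WeaklyAdmissible.of_mem hz.1 hz.2).periodMap_eq

/-- If the period of the linearization at the equilibrium is less than `L`, then so is the period
of all small oscillations. -/
theorem exists_periodMap_lt (hr : 0 < rOf c) (hL : 0 < L)
    (hlin : 4 * π ^ 2 * √(sOf c) < L ^ 2 * (√(sOf c) - 1)) :
    ∃ a ∈ admissible c, periodMap a c < L := by
  have hs0 := sOf_pos_of_rOf_pos hr
  have hs : 1 + 4 * rOf c = sOf c := by unfold rOf sOf; ring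
  have hsq := Real.sq_sqrt hs0.le
  have hs1 : 1 < √(sOf c) := Real.lt_sqrt_of_sq_lt (by linarith)
  -- The equilibrium, with `2a + 1 = √s` and `α₃ = α₄ = a`. It is only weakly admissible; the strict
  -- inequality there passes by continuity to points on its right.
  set a := (-1 + √(1 + 4 * rOf c)) / 2 with ha
  rw [hs] at ha
  have ha0 : 0 < a := by rw [ha]; linarith
  have hae : a ^ 2 + a = rOf c := by rw [ha]; linear_combination (1 / 4) * hsq - (1 / 4) * hs
  have hw : WeaklyAdmissible a c := ⟨ha0, hae.ge, by nlinarith⟩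
  have hb : √3 * √(betaOf a c) = 6 * a + 3 := by
    rw [← Real.sqrt_mul (by norm_num), Real.sqrt_eq_iff_mul_self_eq
      (by linarith [hw.betaOf_pos]) (by linarith), betaOf, ← hae]
    ring
  have hP : a * (alpha3 a c - alpha1 a c) = 3 / 4 * (√(sOf c) - 1) * √(sOf c) := by
    rw [alpha3, alpha1, hb, ha]
    ring
  have hQ : alpha3 a c * (a - alpha1 a c) = 3 / 4 * (√(sOf c) - 1) * √(sOf c) := by
    rw [alpha3, alpha1, hb, ha]
    ring
  -- The square of the left side is `4π²√s / (√s - 1)`, so the claim is `hlin`.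
  have hlt : 2 * √(3 * sOf c) * gaussIntegral (a * (alpha3 a c - alpha1 a c))
      (alpha3 a c * (a - alpha1 a c)) < L := by
    have hX : 0 < 3 / 4 * (√(sOf c) - 1) * √(sOf c) :=
      mul_pos (mul_pos (by norm_num) (by linarith)) (by linarith)
    rw [hP, hQ, gaussIntegral_self, mul_div_assoc', div_lt_iff₀ (sqrt_pos.2 hX)]
    refine lt_of_pow_lt_pow_left₀ 2 (by positivity) ?_
    rw [mul_pow, mul_pow, mul_pow, Real.sq_sqrt (by positivity), Real.sq_sqrt hX.le]
    nlinarith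
  have hc : ContinuousAt (fun x => 2 * √(3 * sOf c) * gaussIntegral (x * (alpha3 x c - alpha1 x c))
      (alpha3 x c * (x - alpha1 x c))) a :=
    (contDiffAt_gaussPeriod hw).continuousAt.comp (f := fun x => (c, x)) (by fun_prop)
  have hlh : a < (-3 + √(9 + 48 * rOf c)) / 4 := by
    have : 4 * a + 3 < √(9 + 48 * rOf c) := Real.lt_sqrt_of_sq_lt (by nlinarith)
    linarith
  have h1 : ∀ᶠ x in 𝓝[>] a, 2 * √(3 * sOf c) * gaussIntegral (x * (alpha3 x c - alpha1 x c))
      (alpha3 x c * (x - alpha1 x c)) < L :=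
    (hc.eventually_lt_const hlt).filter_mono nhdsWithin_le_nhds
  obtain ⟨x, hx1, hx2⟩ := (h1.and (Ioo_mem_nhdsGT hlh)).exists
  have hx : x ∈ admissible c := hx2
  exact ⟨x, hx, by rwa [(WeaklyAdmissible.of_mem hr hx).periodMap_eq]⟩

/-- The period is unbounded near the separatrix. -/
theorem exists_lt_periodMap (hr : 0 < rOf c) (L : ℝ) :
    ∃ a ∈ admissible c, L < periodMap a c := by
  have hs0 := sOf_pos_of_rOf_pos hr
  -- At `b` the root `α₃` vanishes: the first Gauss argument stays positive, the second tends to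
  -- `0`, and the logarithmic bound diverges.
  set b := (-3 + √(9 + 48 * rOf c)) / 4 with hb
  have h2 : 3 < √(9 + 48 * rOf c) := Real.lt_sqrt_of_sq_lt (by linarith)
  have e2 := Real.sq_sqrt (show 0 ≤ 9 + 48 * rOf c by positivity)
  have hb0 : 0 < b := by rw [hb]; linarith
  have hbe : b ^ 2 + 3 / 2 * b = 3 * rOf c := by rw [hb]; linear_combination (1 / 16) * e2
  have hlh : (-1 + √(1 + 4 * rOf c)) / 2 < b := by
    have : √(1 + 4 * rOf c) < 2 * b + 1 := (Real.sqrt_lt' (by linarith)).2 (by nlinarith)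
    linarith
  have hbS : √3 * √(betaOf b c) = 2 * b + 3 := by
    have h3b : 3 * betaOf b c = (2 * b + 3) ^ 2 := by
      unfold betaOf
      linear_combination (-16) * hbe
    rw [← Real.sqrt_mul (by norm_num), h3b, Real.sqrt_sq (by linarith)]
  have h3 : alpha3 b c = 0 := by rw [alpha3, hbS]; ring
  have h1 : alpha1 b c = -(2 * b + 3) / 2 := by rw [alpha1, hbS]; ring
  have hc1 : Continuous fun x => alpha1 x c := by unfold alpha1 betaOf; fun_prop
  have hc3 : Continuous fun x => alpha3 x c := by unfold alpha3 betaOf; fun_prop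
  set P : ℝ → ℝ := fun x => √(x * (alpha3 x c - alpha1 x c)) with hP
  set Q : ℝ → ℝ := fun x => √(alpha3 x c * (x - alpha1 x c)) with hQ
  have hcP : Continuous P := by fun_prop
  have hcQ : Continuous Q := by fun_prop
  have hP0 : 0 < P b := by
    simp only [hP, h3, h1]
    refine sqrt_pos.2 (mul_pos hb0 (by linarith))
  have hQ0 : Q b = 0 := by simp [hQ, h3]
  have hmem : ∀ᶠ x in 𝓝[<] b, x ∈ admissible c := Ioo_mem_nhdsLT hlh
  have tP : Tendsto P (𝓝[<] b) (𝓝 (P b)) := hcP.continuousAt.tendsto.mono_left nhdsWithin_le_nhds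
  have tQ : Tendsto Q (𝓝[<] b) (𝓝 0) := by
    have := (hcQ.continuousAt (x := b)).tendsto.mono_left (nhdsWithin_le_nhds (s := Iio b))
    rwa [hQ0] at this
  have tQ' : Tendsto Q (𝓝[<] b) (𝓝[>] 0) := by
    refine tendsto_nhdsWithin_iff.2 ⟨tQ, hmem.mono fun x hx => ?_⟩
    exact sqrt_pos.2 (WeaklyAdmissible.of_mem hr hx).sub_pos'
  have t1 : Tendsto (fun x => (P x * (π / 2) + Q x) / Q x) (𝓝[<] b) atTop :=
    Tendsto.pos_mul_atTop (C := P b * (π / 2) + 0) (by positivity)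
      ((tP.mul_const _).add tQ) tQ'.inv_tendsto_nhdsGT_zero
  have t2 : Tendsto (fun x => 2 * √(3 * sOf c) * ((P x)⁻¹ * log ((P x * (π / 2) + Q x) / Q x)))
      (𝓝[<] b) atTop :=
    Tendsto.const_mul_atTop (by positivity)
      (Tendsto.pos_mul_atTop (inv_pos.2 hP0) (tP.inv₀ hP0.ne') (tendsto_log_atTop.comp t1))
  obtain ⟨x, hx1, hx2⟩ := ((t2.eventually_gt_atTop L).and hmem).exists
  have hw := WeaklyAdmissible.of_mem hr hx2
  refine ⟨x, hx2, hx1.trans_le ?_⟩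
  rw [hw.periodMap_eq]
  exact mul_le_mul_of_nonneg_left (le_gaussIntegral hw.sub_pos hw.sub_pos') (by positivity)

theorem existsUnique_periodMap_eq (hr : 0 < rOf c) (hL : 0 < L)
    (hlin : 4 * π ^ 2 * √(sOf c) < L ^ 2 * (√(sOf c) - 1)) :
    ∃! a : ℝ, a ∈ admissible c ∧ periodMap a c = L := by
  obtain ⟨a, ha, haL⟩ := exists_periodMap_lt hr hL hlin
  obtain ⟨b, hb, hbL⟩ := exists_lt_periodMap hr L
  have hmono := strictMonoOn_periodMap hr
  have hab : a < b := (hmono.lt_iff_lt ha hb).1 (haL.trans hbL)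
  have hsub : Icc a b ⊆ admissible c := Icc_subset_Ioo ha.1 hb.2
  have hcont : ContinuousOn (fun x => periodMap x c) (Icc a b) := fun x hx => by
    obtain ⟨d, -, hd⟩ := hasDerivAt_periodMap hr (hsub hx)
    exact hd.continuousAt.continuousWithinAt
  obtain ⟨x, hx, hxL⟩ := intermediate_value_Icc hab.le hcont ⟨haL.le, hbL.le⟩
  exact ⟨x, ⟨hsub hx, hxL⟩, fun y hy => hmono.injOn hy.1 (hsub hx) (hy.2.trans hxL.symm)⟩

/-- The hypothesis on `L` is the linearization condition at `c = 0`, where `s = 5`. -/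
theorem sqrt_five_cond (hL : 2 * π * √(√5 / (√5 - 1)) < L) :
    4 * π ^ 2 * √5 < L ^ 2 * (√5 - 1) := by
  have h5 : 1 < √5 := Real.lt_sqrt_of_sq_lt (by norm_num)
  have h0 : 0 < √5 - 1 := by linarith
  have h1 := pow_lt_pow_left₀ hL (by positivity) two_ne_zero
  rw [mul_pow, mul_pow, Real.sq_sqrt (by positivity), mul_div_assoc', div_lt_iff₀ h0] at h1
  linarith

theorem sq_sub_pos (hL : 2 * π * √(√5 / (√5 - 1)) < L) : 0 < L ^ 2 - 4 * π ^ 2 := by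
  have h1 := sqrt_five_cond hL
  have h5 : 1 < √5 := Real.lt_sqrt_of_sq_lt (by norm_num)
  have := pi_pos
  by_contra h
  nlinarith [sq_nonneg L, sq_nonneg π]

theorem speedBound_pos (hL : 2 * π * √(√5 / (√5 - 1)) < L) : 0 < speedBound L := by
  have h1 := sqrt_five_cond hL
  have h2 := sq_sub_pos hL
  have h3 : L ^ 4 / (L ^ 2 - 4 * π ^ 2) ^ 2 < 5 := by
    rw [div_lt_iff₀ (by positivity)]
    have h4 : L ^ 2 < √5 * (L ^ 2 - 4 * π ^ 2) := by linarith
    have h5 := pow_lt_pow_left₀ h4 (by positivity) two_ne_zero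
    rw [mul_pow, Real.sq_sqrt (by norm_num)] at h5
    linarith
  unfold speedBound
  have := sqrt_pos.2 (sub_pos.2 h3)
  linarith

/-- `|c| < c_L` says `√s > L² / (L² - 4π²)`, which rearranges to the linearization condition. The
right side exceeds `1`, so `s > 1`, which is `r > 0`. -/
theorem subcritical (hL : 2 * π * √(√5 / (√5 - 1)) < L)
    (hc : c ∈ Ioo (-speedBound L) (speedBound L)) :
    0 < rOf c ∧ 4 * π ^ 2 * √(sOf c) < L ^ 2 * (√(sOf c) - 1) := by
  have h2 := sq_sub_pos hL
  have h3 : |2 * c| < √(5 - L ^ 4 / (L ^ 2 - 4 * π ^ 2) ^ 2) := by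
    have := hc.1
    have := hc.2
    unfold speedBound at *
    rw [abs_lt]
    constructor <;> linarith
  have h4 := Real.lt_sqrt (abs_nonneg (2 * c)) |>.1 h3
  rw [sq_abs] at h4
  have h5 : (L ^ 2 / (L ^ 2 - 4 * π ^ 2)) ^ 2 < sOf c := by
    rw [div_pow, ← pow_mul]
    unfold sOf
    linarith
  have h6 : 1 < L ^ 2 / (L ^ 2 - 4 * π ^ 2) := by
    rw [one_lt_div h2]
    have := pi_pos
    nlinarith
  have h7 := Real.lt_sqrt_of_sq_lt h5
  rw [div_lt_iff₀ h2] at h7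
  refine ⟨?_, by linarith⟩
  have : 1 < sOf c := (one_lt_pow₀ h6 two_ne_zero).trans h5
  unfold sOf at this
  unfold rOf
  linarith

/-- Solutions of `T(α, c) = L` depend smoothly on `c`. -/
theorem contDiffAt_of_periodMap_eq {Λ : ℝ → ℝ} {U : Set ℝ} (hU : IsOpen U)
    (hr : ∀ x ∈ U, 0 < rOf x) (hΛ : ∀ x ∈ U, Λ x ∈ admissible x ∧ periodMap (Λ x) x = L)
    (hc : c ∈ U) : ContDiffAt ℝ ∞ Λ c := by
  obtain ⟨d, hd, hd'⟩ := hasDerivAt_periodMap (hr c hc) (hΛ c hc).1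
  refine contDiffAt_of_implicit (f := fun z : ℝ × ℝ => periodMap z.2 z.1)
    (contDiffAt_periodMap (hr c hc) (hΛ c hc).1) hd' hd.ne' (hΛ c hc).2 ?_
  filter_upwards [eventually_admissible (hr c hc) (hΛ c hc).1,
    (continuousAt_fst (p := (c, Λ c))).eventually (hU.mem_nhds hc)]
    with z hz hzU hzL
  exact (strictMonoOn_periodMap hz.1).injOn hz.2 (hΛ _ hzU).1 (hzL.trans (hΛ _ hzU).2.symm)

/-- For `α > 0` the condition `k² ∈ (0, 1)` characterizes the admissible values. -/
theorem mem_admissible_iff_modulusSq (hr : 0 < rOf c) (hα : 0 < α) :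
    α ∈ admissible c ↔ modulusSq α c ∈ Ioo 0 1 := by
  constructor
  · intro h
    have hw := WeaklyAdmissible.of_mem hr h
    refine ⟨hw.modulusSq_nonneg.lt_of_ne fun h0 => ?_, hw.modulusSq_lt_one⟩
    have h1 := hw.one_sub_modulusSq
    rw [← h0, sub_zero, mul_one] at h1
    have h2 : alpha1 α c * (α - alpha3 α c) = 0 := by linarith
    rcases mul_eq_zero.1 h2 with h3 | h3
    · exact hw.alpha1_neg.ne h3
    · have h4 : √3 * √(betaOf α c) = 6 * α + 3 := by unfold alpha3 at h3; linarith
      have h5 := hw.sq_sqrt_three_mul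
      rw [h4, betaOf] at h5
      linarith [((mem_admissible_iff hr).1 h).2.1]
  · rintro ⟨h0, h1⟩
    -- For `β ≤ 0` the square root is `0` and `modulusSq` is a division by zero with value `0`,
    -- outside the interval.
    have hb : 0 < betaOf α c := by
      by_contra hb
      rw [modulusSq, Real.sqrt_eq_zero_of_nonpos (not_lt.1 hb)] at h0
      simp at h0
    have hS2 : (√3 * √(betaOf α c)) ^ 2 = 3 * betaOf α c := by
      rw [mul_pow, Real.sq_sqrt (by norm_num), Real.sq_sqrt hb.le]
    have hS0 : 0 < √3 * √(betaOf α c) := by positivity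
    have hden : 2 * √3 * α * √(betaOf α c) = 2 * α * (√3 * √(betaOf α c)) := by ring
    have hnum : 6 * α ^ 2 + 9 * α - 12 * rOf c + α * √3 * √(betaOf α c) =
        6 * α ^ 2 + 9 * α - 12 * rOf c + α * (√3 * √(betaOf α c)) := by ring
    rw [modulusSq, hden, hnum] at h0 h1
    set S := √3 * √(betaOf α c) with hS
    rw [div_lt_one (by positivity)] at h1
    have h0' : 0 < 6 * α ^ 2 + 9 * α - 12 * rOf c + α * S :=
      (div_pos_iff_of_pos_right (by positivity)).1 h0
    unfold betaOf at hS2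
    rw [mem_admissible_iff hr]
    refine ⟨hα, ?_, ?_⟩
    -- The product is `16(α₄ - α₃)(-α₁)`, positive because `k² > 0`; in the other case `16α₃(α₄ -
    -- α₁)`, positive because `k² < 1`. The second factors are positive outright.
    · have h2 : 0 < (6 * α + 3 - S) * (2 * α + 3 + S) := by nlinarith
      have h3 : S < 6 * α + 3 := by linarith [(mul_pos_iff_of_pos_right (by positivity)).1 h2]
      nlinarith
    · have h2 : 0 < (S - (2 * α + 3)) * (6 * α + 3 + S) := by nlinarith
      have h3 : 2 * α + 3 < S := by linarith [(mul_pos_iff_of_pos_right (by positivity)).1 h2]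
      nlinarith

end PeriodMap

/-! ### The dnoidal profile: smoothness, equation and period -/

section Profile

open Filter Topology

variable {α c L : ℝ}

/-- The frequency `2 / (g √(3s))` of the profile. -/
noncomputable def profileFreq (α c : ℝ) : ℝ := 2 / (gOf α c * √(3 * sOf c))

theorem profile_eq (α c x : ℝ) : profile α c x =
    √α * √(1 - modulus α c ^ 2 * sin (jacobiAm (profileFreq α c * x) (modulus α c)) ^ 2) /
      √(1 + snCoeff α c * sin (jacobiAm (profileFreq α c * x) (modulus α c)) ^ 2) := rfl

namespace WeaklyAdmissible

variable (h : WeaklyAdmissible α c)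
include h

theorem profileFreq_eq : profileFreq α c = √(α * (alpha3 α c - alpha1 α c)) / √(3 * sOf c) := by
  have := sqrt_pos.2 h.sub_pos
  have := sOf_pos_of_rOf_pos h.rOf_pos
  have : 0 < √(3 * sOf c) := by positivity
  unfold profileFreq gOf
  field_simp

theorem profileFreq_pos : 0 < profileFreq α c := by
  rw [h.profileFreq_eq]
  have := sqrt_pos.2 h.sub_pos
  have := sOf_pos_of_rOf_pos h.rOf_pos
  positivity

theorem profileFreq_sq :
    profileFreq α c ^ 2 = α * (alpha3 α c - alpha1 α c) / (3 * sOf c) := by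
  have := sOf_pos_of_rOf_pos h.rOf_pos
  rw [h.profileFreq_eq, div_pow, Real.sq_sqrt h.sub_pos.le, Real.sq_sqrt (by positivity)]

theorem profileFreq_mul_periodMap :
    profileFreq α c * periodMap α c = 2 * ellipticK (modulus α c) := by
  rw [h.periodMap_eq, ← h.one_sub_modulusSq, ← h.modulus_sq,
    ← ellipticK_div h.sub_pos h.modulus_sq_lt_one, h.profileFreq_eq]
  have := sqrt_pos.2 h.sub_pos
  have := sOf_pos_of_rOf_pos h.rOf_pos
  have : 0 < √(3 * sOf c) := by positivity
  field_simp

theorem snCoeff_eq :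
    snCoeff α c = (α - alpha3 α c) / (alpha3 α c - alpha1 α c) := by
  have h1 := h.alpha1_neg.ne
  have h2 := h.pos.ne'
  have h3 : alpha3 α c - alpha1 α c ≠ 0 := by linarith [h.alpha1_neg, h.alpha3_pos]
  rw [snCoeff, h.modulusSq_eq]
  field_simp

theorem snCoeff_nonneg : 0 ≤ snCoeff α c := by
  rw [h.snCoeff_eq]
  exact div_nonneg (by linarith [h.alpha3_le]) (by linarith [h.alpha1_neg, h.alpha3_pos])

end WeaklyAdmissible

theorem one_add_mul_sin_sq_pos {ν : ℝ} (hν : 0 ≤ ν) (θ : ℝ) : 0 < 1 + ν * sin θ ^ 2 := by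
  positivity

theorem contDiffAt_profile {Λ : ℝ → ℝ} (hΛ : ContDiffAt ℝ ∞ Λ c) (hr : 0 < rOf c)
    (hα : Λ c ∈ admissible c) (x : ℝ) :
    ContDiffAt ℝ ∞ (fun z : ℝ × ℝ => profile (Λ z.1) z.1 z.2) (c, x) := by
  have h := WeaklyAdmissible.of_mem hr hα
  -- Strict positivity of `k²` is what makes `modulus`, a square root, smooth.
  have hm0 := ((mem_admissible_iff_modulusSq hr h.pos).1 hα).1
  have hs0 := sOf_pos_of_rOf_pos hr
  have hA : ContDiffAt ℝ ∞ (fun z : ℝ × ℝ => Λ z.1) (c, x) :=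
    ContDiffAt.comp (g := Λ) (f := Prod.fst) (c, x) hΛ contDiffAt_fst
  have hpair : ContDiffAt ℝ ∞ (fun z : ℝ × ℝ => (z.1, Λ z.1)) (c, x) := contDiffAt_fst.prodMk hA
  have h1 : ContDiffAt ℝ ∞ (fun z : ℝ × ℝ => alpha1 (Λ z.1) z.1) (c, x) :=
    (contDiffAt_alpha1 h.betaOf_pos).comp (f := fun z : ℝ × ℝ => (z.1, Λ z.1)) (c, x) hpair
  have h3 : ContDiffAt ℝ ∞ (fun z : ℝ × ℝ => alpha3 (Λ z.1) z.1) (c, x) :=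
    (contDiffAt_alpha3 h.betaOf_pos).comp (f := fun z : ℝ × ℝ => (z.1, Λ z.1)) (c, x) hpair
  have hb : ContDiffAt ℝ ∞ (fun z : ℝ × ℝ => √(betaOf (Λ z.1) z.1)) (c, x) :=
    ((contDiffAt_betaOf c (Λ c)).comp (f := fun z : ℝ × ℝ => (z.1, Λ z.1)) (c, x) hpair).sqrt
      h.betaOf_pos.ne'
  have hrs : ContDiffAt ℝ ∞ (fun z : ℝ × ℝ => rOf z.1) (c, x) := by unfold rOf; fun_prop
  have hss : ContDiffAt ℝ ∞ (fun z : ℝ × ℝ => √(3 * sOf z.1)) (c, x) := by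
    refine ContDiffAt.sqrt ?_ (by positivity)
    unfold sOf
    fun_prop
  have hm : ContDiffAt ℝ ∞ (fun z : ℝ × ℝ => modulusSq (Λ z.1) z.1) (c, x) := by
    unfold modulusSq
    refine ContDiffAt.div (by fun_prop) (by fun_prop) ?_
    have := h.pos
    have := sqrt_pos.2 h.betaOf_pos
    positivity
  have hk : ContDiffAt ℝ ∞ (fun z : ℝ × ℝ => modulus (Λ z.1) z.1) (c, x) := hm.sqrt hm0.ne'
  have hν : ContDiffAt ℝ ∞ (fun z : ℝ × ℝ => snCoeff (Λ z.1) z.1) (c, x) :=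
    (hA.div h1.neg (neg_ne_zero.2 h.alpha1_neg.ne)).mul hm
  have hg0 := sqrt_pos.2 h.sub_pos
  have hg : ContDiffAt ℝ ∞ (fun z : ℝ × ℝ => gOf (Λ z.1) z.1) (c, x) := by
    unfold gOf
    exact contDiffAt_const.div ((hA.mul (h3.sub h1)).sqrt h.sub_pos.ne') hg0.ne'
  have hω : ContDiffAt ℝ ∞ (fun z : ℝ × ℝ => profileFreq (Λ z.1) z.1) (c, x) := by
    refine contDiffAt_const.div (hg.mul hss) ?_
    unfold gOf
    positivity
  have ham : ContDiffAt ℝ ∞ (fun z : ℝ × ℝ =>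
      sin (jacobiAm (profileFreq (Λ z.1) z.1 * z.2) (modulus (Λ z.1) z.1))) (c, x) := by
    refine ContDiffAt.sin ?_
    exact (contDiffAt_jacobiAm h.modulus_sq_lt_one (profileFreq (Λ c) c * x)).comp
      (f := fun z : ℝ × ℝ => (profileFreq (Λ z.1) z.1 * z.2, modulus (Λ z.1) z.1)) (c, x)
      ((hω.mul contDiffAt_snd).prodMk hk)
  simp only [profile_eq]
  have hD := one_sub_sq_mul_sin_sq_pos h.modulus_sq_lt_one
    (jacobiAm (profileFreq (Λ c) c * x) (modulus (Λ c) c))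
  have hR := one_add_mul_sin_sq_pos h.snCoeff_nonneg
    (jacobiAm (profileFreq (Λ c) c * x) (modulus (Λ c) c))
  refine ((hA.sqrt h.pos.ne').mul (ContDiffAt.sqrt ?_ hD.ne')).div (ContDiffAt.sqrt ?_ hR.ne')
    (sqrt_pos.2 hR).ne'
  · exact contDiffAt_const.sub ((hk.pow 2).mul (ham.pow 2))
  · exact contDiffAt_const.add (hν.mul (ham.pow 2))

theorem contDiff_profile (hr : 0 < rOf c) (hα : α ∈ admissible c) :
    ContDiff ℝ ∞ (profile α c) :=
  contDiff_iff_contDiffAt.2 fun x =>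
    (contDiffAt_profile (Λ := fun _ => α) contDiffAt_const hr hα x).comp
      (f := fun y : ℝ => (c, y)) x (by fun_prop)

section Derivatives

variable {k ν A w : ℝ}

theorem hasDerivAt_jacobiAm_mul (hk : k ^ 2 < 1) (w x : ℝ) :
    HasDerivAt (fun x => jacobiAm (w * x) k)
      (w * √(1 - k ^ 2 * sin (jacobiAm (w * x) k) ^ 2)) x := by
  have h1 := (hasDerivAt_jacobiAm hk (w * x)).comp x ((hasDerivAt_id x).const_mul w)
  exact h1.congr_deriv (by simp; ring)

theorem hasDerivAt_sqrt_one_add (hν : 0 ≤ ν) (θ : ℝ) :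
    HasDerivAt (fun θ => √(1 + ν * sin θ ^ 2))
      (ν * sin θ * cos θ / √(1 + ν * sin θ ^ 2)) θ := by
  have h0 := one_add_mul_sin_sq_pos hν θ
  have h1 := ((((hasDerivAt_sin θ).pow 2).const_mul ν).const_add 1).sqrt h0.ne'
  refine h1.congr_deriv ?_
  have := sqrt_pos.2 h0
  simp only [Pi.pow_apply]
  field_simp
  simp
  ring

theorem hasDerivAt_sqrt_one_sub (hk : k ^ 2 < 1) (θ : ℝ) :
    HasDerivAt (fun θ => √(1 - k ^ 2 * sin θ ^ 2))
      (-(k ^ 2 * sin θ * cos θ) / √(1 - k ^ 2 * sin θ ^ 2)) θ := by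
  have h0 := one_sub_sq_mul_sin_sq_pos hk θ
  have h1 := ((((hasDerivAt_sin θ).pow 2).const_mul (k ^ 2)).const_sub 1).sqrt h0.ne'
  refine h1.congr_deriv ?_
  have := sqrt_pos.2 h0
  simp only [Pi.pow_apply]
  field_simp
  simp
  ring

/-- The inner derivative `am' = dn` cancels the `dn` in the denominator, and `k²(1 + ν sn²) + ν(1 -
k² sn²) = k² + ν` is constant. -/
theorem hasDerivAt_dn_div (hk : k ^ 2 < 1) (hν : 0 ≤ ν) (A w x : ℝ) :
    HasDerivAt (fun x => A * √(1 - k ^ 2 * sin (jacobiAm (w * x) k) ^ 2) /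
        √(1 + ν * sin (jacobiAm (w * x) k) ^ 2))
      (-(A * w * (k ^ 2 + ν)) * (sin (jacobiAm (w * x) k) * cos (jacobiAm (w * x) k) /
        √(1 + ν * sin (jacobiAm (w * x) k) ^ 2) ^ 3)) x := by
  set θ := jacobiAm (w * x) k with hθ
  have hD := sqrt_pos.2 (one_sub_sq_mul_sin_sq_pos hk θ)
  have hR := sqrt_pos.2 (one_add_mul_sin_sq_pos hν θ)
  have hD2 := Real.sq_sqrt (one_sub_sq_mul_sin_sq_pos hk θ).le
  have hR2 := Real.sq_sqrt (one_add_mul_sin_sq_pos hν θ).le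
  have h1 := ((hasDerivAt_sqrt_one_sub hk θ).const_mul A).div (hasDerivAt_sqrt_one_add hν θ) hR.ne'
  have h2 := h1.comp x (hasDerivAt_jacobiAm_mul hk w x)
  refine h2.congr_deriv ?_
  rw [← hθ]
  set D := √(1 - k ^ 2 * sin θ ^ 2)
  set R := √(1 + ν * sin θ ^ 2)
  field_simp
  linear_combination (-A * w * sin θ * cos θ * k ^ 2) * hR2 - (A * w * sin θ * cos θ * ν) * hD2

theorem hasDerivAt_sn_mul_cn_div (hk : k ^ 2 < 1) (hν : 0 ≤ ν) (B w x : ℝ) :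
    HasDerivAt (fun x => B * (sin (jacobiAm (w * x) k) * cos (jacobiAm (w * x) k) /
        √(1 + ν * sin (jacobiAm (w * x) k) ^ 2) ^ 3))
      (B * w * √(1 - k ^ 2 * sin (jacobiAm (w * x) k) ^ 2) *
        ((1 - 2 * sin (jacobiAm (w * x) k) ^ 2) * (1 + ν * sin (jacobiAm (w * x) k) ^ 2) -
          3 * ν * sin (jacobiAm (w * x) k) ^ 2 * (1 - sin (jacobiAm (w * x) k) ^ 2)) /
        √(1 + ν * sin (jacobiAm (w * x) k) ^ 2) ^ 5) x := by
  set θ := jacobiAm (w * x) k with hθ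
  have hR := sqrt_pos.2 (one_add_mul_sin_sq_pos hν θ)
  have hR2 := Real.sq_sqrt (one_add_mul_sin_sq_pos hν θ).le
  have h1 := (((hasDerivAt_sin θ).mul (hasDerivAt_cos θ)).div ((hasDerivAt_sqrt_one_add hν θ).pow 3)
    (pow_ne_zero 3 hR.ne')).const_mul B
  have h2 := h1.comp x (hasDerivAt_jacobiAm_mul hk w x)
  refine h2.congr_deriv ?_
  rw [← hθ]
  simp only [Pi.mul_apply, Pi.pow_apply]
  set D := √(1 - k ^ 2 * sin θ ^ 2)
  set R := √(1 + ν * sin θ ^ 2)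
  rw [← hR2]
  have hc : cos θ ^ 2 = 1 - sin θ ^ 2 := cos_sq' θ
  field_simp
  push_cast
  ring_nf
  rw [hc]
  ring

end Derivatives

theorem solvesProfileEq_profile (hr : 0 < rOf c) (hα : α ∈ admissible c) :
    SolvesProfileEq c (profile α c) := by
  have h := WeaklyAdmissible.of_mem hr hα
  refine ⟨contDiff_infty.1 (contDiff_profile hr hα) 2, fun x => ?_⟩
  have hk := h.modulus_sq_lt_one
  have hν := h.snCoeff_nonneg
  have hs := sOf_pos_of_rOf_pos hr
  have e1 : deriv (profile α c) = _ := funext fun x =>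
    (hasDerivAt_dn_div hk hν (√α) (profileFreq α c) x).deriv
  rw [iteratedDeriv_succ, iteratedDeriv_one, e1,
    (hasDerivAt_sn_mul_cn_div hk hν _ (profileFreq α c) x).deriv, profile_eq]
  set S := sin (jacobiAm (profileFreq α c * x) (modulus α c))
  have hD2 := Real.sq_sqrt (one_sub_sq_mul_sin_sq_pos hk
    (jacobiAm (profileFreq α c * x) (modulus α c))).le
  have hR2 := Real.sq_sqrt (one_add_mul_sin_sq_pos hν
    (jacobiAm (profileFreq α c * x) (modulus α c))).le
  have hR := sqrt_pos.2 (one_add_mul_sin_sq_pos hν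
    (jacobiAm (profileFreq α c * x) (modulus α c)))
  have hω := h.profileFreq_sq
  have hA := Real.sq_sqrt h.pos.le
  change √(1 - modulus α c ^ 2 * S ^ 2) ^ 2 = 1 - modulus α c ^ 2 * S ^ 2 at hD2
  change √(1 + snCoeff α c * S ^ 2) ^ 2 = 1 + snCoeff α c * S ^ 2 at hR2
  change 0 < √(1 + snCoeff α c * S ^ 2) at hR
  -- The equation times `sR⁵`, without its common factor `√α₄ D`: a polynomial identity in `S = sn`,
  -- which follows from Vieta's relations.
  have key : profileFreq α c ^ 2 * sOf c * (modulus α c ^ 2 + snCoeff α c) *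
      ((1 - 2 * S ^ 2) * (1 + snCoeff α c * S ^ 2) - 3 * snCoeff α c * S ^ 2 * (1 - S ^ 2)) +
      (rOf c * (1 + snCoeff α c * S ^ 2) ^ 2 -
        α * (1 - modulus α c ^ 2 * S ^ 2) * (1 + snCoeff α c * S ^ 2) -
        α ^ 2 * (1 - modulus α c ^ 2 * S ^ 2) ^ 2) = 0 := by
    have h1 := h.pos.ne'
    have h3 : alpha3 α c - alpha1 α c ≠ 0 := by linarith [h.alpha1_neg, h.alpha3_pos]
    have h4 := h.alpha1_mul_alpha3
    have h5 : alpha3 α c = -(3 / 2) - α - alpha1 α c := by unfold alpha1 alpha3; ring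
    have h6 : rOf c = (α ^ 2 + 3 / 2 * α - alpha1 α c * alpha3 α c) / 3 := by linarith
    rw [hω, h.modulus_sq, h.modulusSq_eq, h.snCoeff_eq, h6]
    field_simp
    rw [h5]
    ring
  set D := √(1 - modulus α c ^ 2 * S ^ 2)
  set R := √(1 + snCoeff α c * S ^ 2)
  rw [← hD2, ← hR2] at key
  rw [← hR2]
  have hs' := hs.ne'
  have hR' := hR.ne'
  have e3 : ∀ X : ℝ, X ^ 3 = X * X ^ 2 := fun X => by ring
  have e5 : ∀ X : ℝ, X ^ 5 = X * (X ^ 2) ^ 2 := fun X => by ring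
  rw [e3 (√α * D / R), e5 (√α * D / R), div_pow, mul_pow, hA]
  field_simp
  linear_combination √α * D * key

theorem isFundamentalPeriod_profile (hr : 0 < rOf c) (hα : α ∈ admissible c) :
    IsFundamentalPeriod (profile α c) (periodMap α c) := by
  have h := WeaklyAdmissible.of_mem hr hα
  have hk := h.modulus_sq_lt_one
  have hν := h.snCoeff_nonneg
  have hm0 := ((mem_admissible_iff_modulusSq hr h.pos).1 hα).1
  have hω := h.profileFreq_pos
  have hT := h.profileFreq_mul_periodMap
  have hK := ellipticK_pos hk
  have hT0 : 0 < periodMap α c := by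
    refine (mul_pos_iff_of_pos_left hω).1 ?_
    rw [hT]
    positivity
  refine ⟨hT0, fun x => ?_, fun t ht0 ht hp => ?_⟩
  · rw [profile_eq, profile_eq, mul_add, hT, jacobiAm_add hk, sin_add_pi, neg_sq]
  -- A period `t` makes the profile at `t` equal to its value `√α₄` at `0`. Since `k² + ν > 0`, this
  -- forces `sn = 0`, which first recurs after a full period.
  · have h1 := hp 0
    rw [zero_add, profile_eq, profile_eq, mul_zero, jacobiAm_zero hk, sin_zero] at h1
    set θ := jacobiAm (profileFreq α c * t) (modulus α c) with hθ
    have hR := sqrt_pos.2 (one_add_mul_sin_sq_pos hν θ)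
    have hA := sqrt_pos.2 h.pos
    simp only [ne_eq, OfNat.ofNat_ne_zero, not_false_eq_true, zero_pow, mul_zero, sub_zero, add_zero,
      Real.sqrt_one, mul_one, div_one] at h1
    rw [div_eq_iff hR.ne'] at h1
    have h2 := mul_left_cancel₀ hA.ne' h1
    rw [Real.sqrt_inj (one_sub_sq_mul_sin_sq_pos hk θ).le (one_add_mul_sin_sq_pos hν θ).le,
      h.modulus_sq] at h2
    have h3 : sin θ ^ 2 * (modulusSq α c + snCoeff α c) = 0 := by linarith
    have h4 : sin θ = 0 := by
      rcases mul_eq_zero.1 h3 with h4 | h4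
      · exact pow_eq_zero_iff two_ne_zero |>.1 h4
      · linarith
    have h5 := le_of_jacobiSn_eq_zero hk (mul_pos hω ht0) h4
    rw [← hT] at h5
    exact absurd (le_of_mul_le_mul_left h5 hω) (not_le.2 ht)

end Profile

end CubicQuintic

/-! ### Assembly of the theorem -/

theorem theorem2 (L : ℝ) [Fact (0 < L)] (hL : 2 * π * √(√5 / (√5 - 1)) < L) :
    -- for every admissible speed there is exactly one root `α₄` giving the period `L`
    (∀ c ∈ Ico 0 (CubicQuintic.speedBound L),
      ∃! α : ℝ, α ∈ CubicQuintic.admissible c ∧ CubicQuintic.periodMap α c = L) ∧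
    0 < CubicQuintic.speedBound L ∧
    ∃ Λ : ℝ → ℝ, ∃ I₂ : Set ℝ, IsOpen I₂ ∧ I₂.OrdConnected ∧
      -- `Λ` is a smooth function from `[0, speedBound L)` to `I₂` that solves `T(Λ(c), c) = L`
      ContDiffOn ℝ ∞ Λ (Ico 0 (CubicQuintic.speedBound L)) ∧
      (∀ c ∈ Ico 0 (CubicQuintic.speedBound L),
        Λ c ∈ I₂ ∧ Λ c ∈ CubicQuintic.admissible c ∧
        CubicQuintic.modulusSq (Λ c) c ∈ Ioo 0 1 ∧
        CubicQuintic.periodMap (Λ c) c = L) ∧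
      -- it is the only one, even pointwise
      (∀ c ∈ Ico 0 (CubicQuintic.speedBound L), ∀ α ∈ I₂,
        CubicQuintic.modulusSq α c ∈ Ioo 0 1 → CubicQuintic.periodMap α c = L → α = Λ c) ∧
      -- the profiles are solutions of fundamental period `L`
      (∀ c ∈ Ico 0 (CubicQuintic.speedBound L),
        CubicQuintic.IsFundamentalPeriod (CubicQuintic.profile (Λ c) c) L ∧
        CubicQuintic.SolvesProfileEq c (CubicQuintic.profile (Λ c) c)) ∧
      -- they depend smoothly on the speed in every periodic Sobolev space
      (∀ n : ℕ, ∃ Φ : ℝ → CubicQuintic.PerSobolev L n,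
        (∀ c ∈ Ico 0 (CubicQuintic.speedBound L),
          (Φ c).IsClassOf (CubicQuintic.profile (Λ c) c)) ∧
        ContDiffOn ℝ ∞ Φ (Ico 0 (CubicQuintic.speedBound L))) := by
  have hL0 : 0 < L := Fact.out
  have hpos := CubicQuintic.speedBound_pos hL
  -- Everything depends on `c` through `c²`, so the branch exists on a symmetric open interval;
  -- smoothness at the endpoint `c = 0` becomes an interior statement.
  set U : Set ℝ := Ioo (-CubicQuintic.speedBound L) (CubicQuintic.speedBound L) with hU
  have hsub : Ico 0 (CubicQuintic.speedBound L) ⊆ U := fun c hc =>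
    ⟨(neg_lt_zero.2 hpos).trans_le hc.1, hc.2⟩
  have hr : ∀ c ∈ U, 0 < CubicQuintic.rOf c := fun c hc => (CubicQuintic.subcritical hL hc).1
  have hex : ∀ c ∈ U, ∃! α : ℝ, α ∈ CubicQuintic.admissible c ∧ CubicQuintic.periodMap α c = L :=
    fun c hc => CubicQuintic.existsUnique_periodMap_eq (hr c hc) hL0
      (CubicQuintic.subcritical hL hc).2
  choose! Λ hΛ hΛu using hex
  have hsm : ∀ c ∈ U, ContDiffAt ℝ ∞ Λ c := fun c hc =>
    CubicQuintic.contDiffAt_of_periodMap_eq isOpen_Ioo hr hΛ hc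
  have hα0 : ∀ c ∈ U, 0 < Λ c := fun c hc =>
    (CubicQuintic.WeaklyAdmissible.of_mem (hr c hc) (hΛ c hc).1).pos
  have hper : ∀ c ∈ U, CubicQuintic.IsFundamentalPeriod (CubicQuintic.profile (Λ c) c) L := by
    intro c hc
    have := CubicQuintic.isFundamentalPeriod_profile (hr c hc) (hΛ c hc).1
    rwa [(hΛ c hc).2] at this
  refine ⟨fun c hc => ⟨Λ c, hΛ c (hsub hc), hΛu c (hsub hc)⟩, hpos, Λ, Ioi 0, isOpen_Ioi,
    ordConnected_Ioi, fun c hc => (hsm c (hsub hc)).contDiffWithinAt, fun c hc => ?_,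
    fun c hc α hα hm hT => ?_, fun c hc => ⟨hper c (hsub hc), ?_⟩, fun n => ?_⟩
  · have hc := hsub hc
    exact ⟨hα0 c hc, (hΛ c hc).1,
      (CubicQuintic.mem_admissible_iff_modulusSq (hr c hc) (hα0 c hc)).1 (hΛ c hc).1, (hΛ c hc).2⟩
  · have hc := hsub hc
    exact hΛu c hc α ⟨(CubicQuintic.mem_admissible_iff_modulusSq (hr c hc) hα).2 hm, hT⟩
  · exact CubicQuintic.solvesProfileEq_profile (hr c (hsub hc)) (hΛ c (hsub hc)).1
  · obtain ⟨Φ, hΦ, hΦs⟩ := CubicQuintic.exists_contDiffOn_perSobolev (L := L) n isOpen_Ioo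
      (u := fun c => CubicQuintic.profile (Λ c) c) (fun z hz =>
        (CubicQuintic.contDiffAt_profile (hsm z.1 hz.1) (hr z.1 hz.1) (hΛ z.1 hz.1).1
          z.2).contDiffWithinAt)
      fun c hc => (hper c hc).2.1
    exact ⟨Φ, fun c hc => hΦ c (hsub hc), hΦs.mono hsub⟩
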